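/- Let $(\Omega,\mathcal F,P)$ be a probability space with a filtration $(\mathcal F_t)_{t\in\{0,\dots,T\}}$ such that $\mathcal F_0$ is ($P$-)trivial and $\mathcal F_T=\mathcal F$, and let $X=(X_t)_{t\in\{0,\dots,T\}}$ be an adapted $\mathbb R^d$-valued process (the discounted prices). All (in)equalities between random variables are understood $P$-almost surely, and $L^0(\mathcal F_t)$ denotes the $\mathcal F_t$-measurable real random variables. A strategy is a $d$-dimensional predictable process $\xi=(\xi_k)_{k=1,\dots,T}$, i.e. $\xi_k$ is $\mathcal F_{k-1}$-measurable; put $(\xi\cdot X)_t=\sum_{k=1}^t \xi_k\cdot(X_k-X_{k-1})$ and $G_t(\xi)=(\xi\cdot X)_T-(\xi\cdot X)_t$. The market $X$ is free of arbitrage if $(\xi\cdot X)_T\ge 0$ implies $(\xi\cdot X)_T=0$ for every strategy $\xi$. Assume that it is. A claim is a random variable $H\in L^0(\mathcal F_T)$ with $H\ge 0$. It is attainable at time $t$ if $H=H_t+G_t(\xi)$ for some $H_t\in L^0(\mathcal F_t)$ and some strategy $\xi$. A random variable $\pi\in L^0(\mathcal F_t)$ is an arbitrage-free price of $H$ at time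 $t$ if there is a real-valued adapted process $Y$ with $Y_t=\pi$ and $Y_T=H$ such that the $(d+1)$-dimensional market $(X,Y)$ is free of arbitrage. Let $\mathcal M_e$ be the set of probability measures $Q\sim P$ on $(\Omega,\mathcal F)$ under which $X$ is a martingale. For equivalent probability measures $Q^1,Q^2$ their pasting at time $t$ is the probability measure $Q^1\odot_t Q^2(A)=E_{Q^1}[Q^2(A\mid\mathcal F_t)]$, $A\in\mathcal F$, and $\mathcal M_e\odot_t Q^*=\{Q\odot_t Q^*: Q\in\mathcal M_e\}$. Then, for every $t\in\{0,\dots,T\}$, the following statements are equivalent: (i) The market is complete at time $t$, i.e. every claim $H$ is attainable at time $t$. (ii) Every claim $H$ has a unique arbitrage-free price at time $t$, i.e. an arbitrage-free price exists and any two agree $P$-a.s. (iii) There exists $Q^*\in\mathcal M_e$ such that $\mathcal M_e=\mathcal M_e\odot_t Q^*$. (iv) For every $Q^*\in\mathcal M_e$, $\mathcal M_e=\mathcal M_e\odot_t Q^*$. -/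

import Mathlib

open MeasureTheory ProbabilityTheory
open scoped ENNReal

namespace CondFTAP

noncomputable section

section Market

variable {Ω : Type*} {mΩ : MeasurableSpace Ω} {T d : ℕ}

/-- A `d`-dimensional predictable process in discrete time with time points `0, …, T`. The value
`ξ k` is the position held over the period from `k` to `k + 1` (the process at time `k + 1`),
so it has to be measurable with respect to the information available at time `k`. -/
def IsPredictableStrategy (ℱ : Filtration (Fin (T + 1)) mΩ) (ξ : Fin T → Ω → Fin d → ℝ) : Prop :=
  ∀ k : Fin T, Measurable[ℱ k.castSucc] (ξ k)

/-- The gains `(ξ · X)_s = ∑_{k = 1}^{s} ξ_k · (X_k - X_{k-1})` from self-financing trading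
in `X` until time `s`. -/
def gainsUntil (X : Fin (T + 1) → Ω → Fin d → ℝ) (ξ : Fin T → Ω → Fin d → ℝ) (s : Fin (T + 1))
    (ω : Ω) : ℝ :=
  ∑ k : Fin T with k.succ ≤ s, ∑ i : Fin d, ξ k ω i * (X k.succ ω i - X k.castSucc ω i)

/-- The gains `G_t(ξ) = (ξ · X)_T - (ξ · X)_t` from trading between `t` and `T`. -/
def gainsFrom (X : Fin (T + 1) → Ω → Fin d → ℝ) (t : Fin (T + 1)) (ξ : Fin T → Ω → Fin d → ℝ)
    (ω : Ω) : ℝ :=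
  gainsUntil X ξ (Fin.last T) ω - gainsUntil X ξ t ω

/-- The market with discounted price process `X` is free of arbitrage: a self-financing strategy
with zero initial capital and a nonnegative terminal gain has terminal gain zero (all `P`-a.s.). -/
def ArbitrageFree (P : Measure Ω) (ℱ : Filtration (Fin (T + 1)) mΩ)
    (X : Fin (T + 1) → Ω → Fin d → ℝ) : Prop :=
  ∀ ξ : Fin T → Ω → Fin d → ℝ, IsPredictableStrategy ℱ ξ →
    (∀ᵐ ω ∂P, 0 ≤ gainsUntil X ξ (Fin.last T) ω) →
    ∀ᵐ ω ∂P, gainsUntil X ξ (Fin.last T) ω = 0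

/-- The market `(X, Y)`: the process `X` with `Y` appended as a further coordinate. -/
def extendMarket (X : Fin (T + 1) → Ω → Fin d → ℝ) (Y : Fin (T + 1) → Ω → ℝ) :
    Fin (T + 1) → Ω → Fin (d + 1) → ℝ :=
  fun s ω => Fin.snoc (α := fun _ => ℝ) (X s ω) (Y s ω)

/-- European contingent claims, i.e. (representatives of) elements of `L⁰₊(ℱ_T)`. -/
def IsClaim (P : Measure Ω) (ℱ : Filtration (Fin (T + 1)) mΩ) (H : Ω → ℝ) : Prop :=
  Measurable[ℱ (Fin.last T)] H ∧ ∀ᵐ ω ∂P, 0 ≤ H ω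

/-- `H` is attainable at time `t`: `H = H_t + G_t(ξ)` a.s. for some `ℱ_t`-measurable `H_t` and some
predictable `ξ`. -/
def Attainable (P : Measure Ω) (ℱ : Filtration (Fin (T + 1)) mΩ)
    (X : Fin (T + 1) → Ω → Fin d → ℝ) (t : Fin (T + 1)) (H : Ω → ℝ) : Prop :=
  ∃ (ξ : Fin T → Ω → Fin d → ℝ) (Ht : Ω → ℝ), IsPredictableStrategy ℱ ξ ∧
    Measurable[ℱ t] Ht ∧ ∀ᵐ ω ∂P, H ω = Ht ω + gainsFrom X t ξ ω

/-- The market is complete at time `t`: every claim is attainable at time `t`. -/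
def CompleteAt (P : Measure Ω) (ℱ : Filtration (Fin (T + 1)) mΩ)
    (X : Fin (T + 1) → Ω → Fin d → ℝ) (t : Fin (T + 1)) : Prop :=
  ∀ H : Ω → ℝ, IsClaim P ℱ H → Attainable P ℱ X t H

/-- `π` is (a representative of) an arbitrage-free price at time `t` of `H`: it is
`ℱ_t`-measurable and the market can be extended by an adapted process `Y` with `Y_t = π` and
`Y_T = H` a.s. such that the extended market `(X, Y)` is free of arbitrage. -/
def IsArbitrageFreePrice (P : Measure Ω) (ℱ : Filtration (Fin (T + 1)) mΩ)
    (X : Fin (T + 1) → Ω → Fin d → ℝ) (t : Fin (T + 1)) (H π : Ω → ℝ) : Prop :=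
  Measurable[ℱ t] π ∧ ∃ Y : Fin (T + 1) → Ω → ℝ, Adapted ℱ Y ∧ Y t =ᵐ[P] π ∧
    Y (Fin.last T) =ᵐ[P] H ∧ ArbitrageFree P ℱ (extendMarket X Y)

/-- `H` has a unique arbitrage-free price at time `t`, as an element of `L⁰(ℱ_t)`. -/
def HasUniquePrice (P : Measure Ω) (ℱ : Filtration (Fin (T + 1)) mΩ)
    (X : Fin (T + 1) → Ω → Fin d → ℝ) (t : Fin (T + 1)) (H : Ω → ℝ) : Prop :=
  ∃ π : Ω → ℝ, IsArbitrageFreePrice P ℱ X t H π ∧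
    ∀ π' : Ω → ℝ, IsArbitrageFreePrice P ℱ X t H π' → π' =ᵐ[P] π

/-- The set `ℳ_e(P)` of martingale measures equivalent to `P`: the probability measures `Q` with
the same null sets as `P` under which every coordinate of `X` is a martingale. -/
def equivMartingaleMeasures (P : Measure Ω) (ℱ : Filtration (Fin (T + 1)) mΩ)
    (X : Fin (T + 1) → Ω → Fin d → ℝ) : Set (ProbabilityMeasure Ω) :=
  {Q | (Q : Measure Ω) ≪ P ∧ P ≪ (Q : Measure Ω) ∧
    ∀ i : Fin d, Martingale (fun s ω => X s ω i) ℱ (Q : Measure Ω)}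

end Market

section Pasting

variable {Ω : Type*}

/-- The pasting `Q₁ ⊙ Q₂` of two probability measures in a sub-σ-algebra `m`,
`(Q₁ ⊙ Q₂)(A) = E_{Q₁}[Q₂(A | m)]`, where the conditional probability `Q₂(A | m)` is taken with
values in `[0, ∞]`. Since `Q₂(A | m)` is determined only `Q₂`-a.s., `Q₁ ≪ Q₂` is needed. -/
def pastingMeasure (m : MeasurableSpace Ω) {mΩ : MeasurableSpace Ω} (Q₁ Q₂ : Measure Ω)
    [IsProbabilityMeasure Q₂] (h : Q₁ ≪ Q₂) : Measure Ω :=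
  Measure.ofMeasurable
    (fun A _ => ∫⁻ ω, condLExp m Q₂ (A.indicator (fun _ => (1 : ℝ≥0∞))) ω ∂Q₁)
    (by
      have h0 : (Set.indicator (∅ : Set Ω) (fun _ => (1 : ℝ≥0∞))) = 0 := by
        ext ω; simp
      simp only [h0, condLExp_zero]
      simp)
    (by
      intro f hf hd
      have h1 : (Set.indicator (⋃ i, f i) (fun _ => (1 : ℝ≥0∞)))
          = ∑' i, (f i).indicator (fun _ => (1 : ℝ≥0∞)) := by
        ext ω
        rw [indicator_iUnion_of_pairwise_disjoint f hd, ENNReal.tsum_apply]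
      have h2 : condLExp m Q₂ (∑' i, (f i).indicator (fun _ => (1 : ℝ≥0∞)))
          =ᵐ[Q₂] ∑' i, condLExp m Q₂ ((f i).indicator (fun _ => (1 : ℝ≥0∞))) :=
        condLExp_tsum m fun i => (measurable_const.indicator (hf i)).aemeasurable
      rw [h1, lintegral_congr_ae (h.ae_eq h2), ← lintegral_tsum]
      · refine lintegral_congr fun ω => ?_
        rw [ENNReal.tsum_apply]
      · exact fun i => (measurable_condLExp' m Q₂ _).aemeasurable)

lemma pastingMeasure_apply (m : MeasurableSpace Ω) {mΩ : MeasurableSpace Ω} (Q₁ Q₂ : Measure Ω)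
    [IsProbabilityMeasure Q₂] (h : Q₁ ≪ Q₂) {A : Set Ω} (hA : MeasurableSet A) :
    pastingMeasure m Q₁ Q₂ h A
      = ∫⁻ ω, condLExp m Q₂ (A.indicator (fun _ => (1 : ℝ≥0∞))) ω ∂Q₁ :=
  Measure.ofMeasurable_apply A hA

/-- The same formula with Mathlib's real-valued conditional probability `Q₂(A | m)`. -/
lemma pastingMeasure_real (m : MeasurableSpace Ω) {mΩ : MeasurableSpace Ω} (Q₁ Q₂ : Measure Ω)
    [IsProbabilityMeasure Q₂] (h : Q₁ ≪ Q₂) {A : Set Ω} (hA : MeasurableSet A) :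
    (pastingMeasure m Q₁ Q₂ h).real A = ∫ ω, (Q₂⟦A | m⟧) ω ∂Q₁ := by
  have hfin : ∫⁻ ω, A.indicator (fun _ => (1 : ℝ≥0∞)) ω ∂Q₂ ≠ ∞ := by
    rw [lintegral_indicator_const hA]
    simp
  have hmeas : AEMeasurable (A.indicator (fun _ => (1 : ℝ≥0∞))) Q₂ :=
    (measurable_const.indicator hA).aemeasurable
  have key := toReal_condLExp m hmeas hfin
  have e : (fun ω => (A.indicator (fun _ => (1 : ℝ≥0∞)) ω).toReal)
      = A.indicator (fun _ => (1 : ℝ)) := by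
    ext ω
    by_cases hω : ω ∈ A <;> simp [hω]
  rw [e] at key
  rw [measureReal_def, pastingMeasure_apply m Q₁ Q₂ h hA,
    ← integral_congr_ae (h.ae_eq key), integral_toReal]
  · exact (measurable_condLExp' m Q₂ _).aemeasurable
  · exact h.ae_le (condLExp_lt_top hfin)

/-- Pasting of probability measures in `m` is a probability measure. -/
def pasting (m : MeasurableSpace Ω) {mΩ : MeasurableSpace Ω} (hm : m ≤ mΩ) (Q₁ Q₂ : ProbabilityMeasure Ω)
    (h : (Q₁ : Measure Ω) ≪ (Q₂ : Measure Ω)) : ProbabilityMeasure Ω :=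
  ⟨pastingMeasure m Q₁ Q₂ h, ⟨by
    rw [pastingMeasure_apply m _ _ h MeasurableSet.univ]
    have h1 : (Set.indicator (Set.univ : Set Ω) (fun _ => (1 : ℝ≥0∞))) = 1 := by
      ext ω; simp
    rw [h1, condLExp_one hm]
    simp⟩⟩

/-- `ℳ ⊙_t Q* = {Q ⊙_t Q* : Q ∈ ℳ}`, for a set `ℳ` of probability measures that are absolutely
continuous with respect to `Q*`, where `m` is the σ-algebra at time `t`. -/
def pastingSet (m : MeasurableSpace Ω) {mΩ : MeasurableSpace Ω} (hm : m ≤ mΩ) (M : Set (ProbabilityMeasure Ω))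
    (Qstar : ProbabilityMeasure Ω) : Set (ProbabilityMeasure Ω) :=
  {R | ∃ Q ∈ M, ∃ h : (Q : Measure Ω) ≪ (Qstar : Measure Ω), R = pasting m hm Q Qstar h}

end Pasting

end

end CondFTAP

namespace CondFTAP

section Selection

variable {B E : Type*} [MeasurableSpace B] [PseudoMetricSpace E] [ProperSpace E]

lemma measurableSet_exists_zero_mem_closedBall {h : B → E → ℝ}
    (hm : ∀ x, Measurable fun b => h b x) (hc : ∀ b, Continuous (h b)) (h0 : ∀ b x, 0 ≤ h b x)
    (q : E) (r : ℝ) : MeasurableSet {b | ∃ x ∈ Metric.closedBall q r, h b x = 0} := by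
  have : Nonempty E := ⟨q⟩
  set e : ℕ → E := TopologicalSpace.denseSeq E
  have he : DenseRange e := TopologicalSpace.denseRange_denseSeq E
  have key : {b | ∃ x ∈ Metric.closedBall q r, h b x = 0} =
      ⋂ n : ℕ, ⋃ j : ℕ, {b | dist (e j) q < r + 1 / ((n : ℝ) + 1) ∧
        h b (e j) < 1 / ((n : ℝ) + 1)} := by
    ext b
    simp only [Set.mem_ofPred_eq, Set.mem_iInter, Set.mem_iUnion]
    constructor
    · rintro ⟨x, hx, hbx⟩ n
      have hn : (0 : ℝ) < 1 / ((n : ℝ) + 1) := Nat.one_div_pos_of_nat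
      have hopen : IsOpen {y | dist y q < r + 1 / ((n : ℝ) + 1) ∧ h b y < 1 / ((n : ℝ) + 1)} :=
        (isOpen_lt (continuous_id.dist continuous_const) continuous_const).and
          (isOpen_lt (hc b) continuous_const)
      obtain ⟨j, hj⟩ := he.exists_mem_open hopen
        ⟨x, by have := Metric.mem_closedBall.1 hx; linarith, by rw [hbx]; exact hn⟩
      exact ⟨j, hj⟩
    · intro H
      choose j hj1 hj2 using H
      obtain ⟨x, -, φ, hφ, hx⟩ := tendsto_subseq_of_bounded
        (Metric.isBounded_closedBall (x := q) (r := r + 1)) (x := fun n => e (j n)) (fun n => by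
          have : 1 / ((n : ℝ) + 1) ≤ 1 := by
            rw [div_le_one (by positivity)]; have : (0 : ℝ) ≤ n := n.cast_nonneg
            linarith
          exact Metric.mem_closedBall.2 (by linarith [hj1 n]))
      have hlim : Filter.Tendsto (fun n : ℕ => 1 / (((φ n : ℕ) : ℝ) + 1)) Filter.atTop (nhds 0) :=
        tendsto_one_div_add_atTop_nhds_zero_nat.comp hφ.tendsto_atTop
      refine ⟨x, ?_, ?_⟩
      · have h1 : Filter.Tendsto (fun n => dist (e (j (φ n))) q) Filter.atTop (nhds (dist x q)) :=
          hx.dist tendsto_const_nhds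
        have h2 := le_of_tendsto_of_tendsto' h1 (hlim.const_add r) fun n => (hj1 (φ n)).le
        simpa using h2
      · have h1 : Filter.Tendsto (fun n => h b (e (j (φ n)))) Filter.atTop (nhds (h b x)) :=
          ((hc b).tendsto x).comp hx
        exact le_antisymm (le_of_tendsto_of_tendsto' h1 hlim fun n => (hj2 (φ n)).le) (h0 b x)
  rw [key]
  refine MeasurableSet.iInter fun n => MeasurableSet.iUnion fun j => ?_
  exact (MeasurableSet.const _).inter (measurableSet_lt (hm _) measurable_const)

lemma exists_measurable_index {p : B → ℕ → Prop} (hp : ∀ j, MeasurableSet {b | p b j}) :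
    ∃ J : B → ℕ, Measurable J ∧ ∀ b, (∃ j, p b j) → p b (J b) := by
  classical
  have hex : ∀ b, ∃ j, p b j ∨ ¬ ∃ i, p b i := fun b => by
    by_cases H : ∃ i, p b i
    · exact H.imp fun _ => Or.inl
    · exact ⟨0, Or.inr H⟩
  refine ⟨fun b => Nat.find (hex b), measurable_find hex fun j => ?_, fun b hb => ?_⟩
  · have : MeasurableSet {b | ∃ i, p b i} := by
      have : {b | ∃ i, p b i} = ⋃ i, {b | p b i} := by ext; simp
      rw [this]
      exact MeasurableSet.iUnion hp
    exact (hp j).union this.compl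
  · exact (Nat.find_spec (hex b)).resolve_right (not_not.2 hb)

/-- Measurable selection of a zero of a nonnegative Carathéodory function. -/
theorem exists_measurable_zero [Nonempty E] [MeasurableSpace E] [BorelSpace E] {h : B → E → ℝ}
    (hm : ∀ x, Measurable fun b => h b x) (hc : ∀ b, Continuous (h b)) (h0 : ∀ b x, 0 ≤ h b x) :
    ∃ g : B → E, Measurable g ∧ ∀ b, (∃ x, h b x = 0) → h b (g b) = 0 := by
  classical
  set e : ℕ → E := TopologicalSpace.denseSeq E
  have he : DenseRange e := TopologicalSpace.denseRange_denseSeq E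
  set M : E → ℝ → Set B := fun q r => {b | ∃ x ∈ Metric.closedBall q r, h b x = 0} with hM
  have hMm : ∀ q r, MeasurableSet (M q r) :=
    measurableSet_exists_zero_mem_closedBall hm hc h0
  obtain ⟨J0, hJ0m, hJ0⟩ := exists_measurable_index (p := fun b j => b ∈ M (e j) 1)
    fun j => hMm _ _
  have step : ∀ n : ℕ, ∃ Φ : B × ℕ → ℕ, Measurable Φ ∧ ∀ b i,
      (∃ j, b ∈ M (e j) (1 / 2 / 2 ^ n) ∧ dist (e i) (e j) ≤ 4 / 2 / 2 ^ n) →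
      (b ∈ M (e (Φ (b, i))) (1 / 2 / 2 ^ n) ∧ dist (e i) (e (Φ (b, i))) ≤ 4 / 2 / 2 ^ n) := by
    intro n
    have := fun i : ℕ => exists_measurable_index
      (p := fun b j => b ∈ M (e j) (1 / 2 / 2 ^ n) ∧ dist (e i) (e j) ≤ 4 / 2 / 2 ^ n)
      fun j => (hMm _ _).inter (MeasurableSet.const _)
    choose Φ hΦm hΦ using this
    exact ⟨fun z => Φ z.2 z.1, measurable_from_prod_countable_left fun i => hΦm i,
      fun b i => hΦ i b⟩
  choose Φ hΦm hΦ using step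
  set J : ℕ → B → ℕ := fun n => Nat.rec J0 (fun n Jn b => Φ n (b, Jn b)) n with hJ
  have hJs : ∀ n b, J (n + 1) b = Φ n (b, J n b) := fun n b => rfl
  have hJm : ∀ n, Measurable (J n) := by
    intro n
    induction n with
    | zero => exact hJ0m
    | succ n ih => exact (hΦm n).comp (measurable_id.prodMk ih)
  have inv : ∀ b, (∃ x, h b x = 0) → ∀ n, b ∈ M (e (J n b)) (1 / 2 ^ n) ∧
      (dist (e (J n b)) (e (J (n + 1) b)) ≤ 4 / 2 / 2 ^ n ∧
        b ∈ M (e (J (n + 1) b)) (1 / 2 ^ (n + 1))) := by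
    intro b hb
    have next : ∀ n, b ∈ M (e (J n b)) (1 / 2 ^ n) →
        (dist (e (J n b)) (e (J (n + 1) b)) ≤ 4 / 2 / 2 ^ n ∧
        b ∈ M (e (J (n + 1) b)) (1 / 2 ^ (n + 1))) := by
      rintro n ⟨x, hx, hbx⟩
      obtain ⟨j, hj⟩ := he.exists_dist_lt x (ε := 1 / 2 / 2 ^ n) (by positivity)
      have := hΦ n b (J n b) ⟨j, ⟨x, hj.le, hbx⟩, by
        have h1 := dist_triangle (e (J n b)) x (e j)
        rw [Metric.mem_closedBall, dist_comm] at hx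
        have h2 : (4 : ℝ) / 2 / 2 ^ n = 1 / 2 ^ n + 1 / 2 / 2 ^ n + 1 / 2 / 2 ^ n := by ring
        have h3 : (0 : ℝ) < 1 / 2 / 2 ^ n := by positivity
        linarith⟩
      rw [hJs]
      refine ⟨this.2, ?_⟩
      have e1 : (1 : ℝ) / 2 ^ (n + 1) = 1 / 2 / 2 ^ n := by rw [pow_succ']; field_simp
      rw [e1]
      exact this.1
    have base : b ∈ M (e (J 0 b)) (1 / 2 ^ 0) := by
      have := hJ0 b (by
        obtain ⟨x, hx⟩ := hb
        obtain ⟨j, hj⟩ := he.exists_dist_lt x one_pos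
        exact ⟨j, x, hj.le, hx⟩)
      have hJ00 : J 0 = J0 := rfl
      rw [hJ00, pow_zero, div_one]
      exact this
    intro n
    induction n with
    | zero => exact ⟨base, next 0 base⟩
    | succ n ih => exact ⟨ih.2.2, next (n + 1) ih.2.2⟩
  set S : Set B := {b | ∃ x, h b x = 0} with hS
  have hSm : MeasurableSet S := by
    have : S = ⋃ j, M (e j) 1 := by
      ext b
      simp only [hS, hM, Set.mem_ofPred_eq, Set.mem_iUnion]
      constructor
      · rintro ⟨x, hx⟩
        obtain ⟨j, hj⟩ := he.exists_dist_lt x one_pos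
        exact ⟨j, x, hj.le, hx⟩
      · rintro ⟨j, x, -, hx⟩
        exact ⟨x, hx⟩
    rw [this]
    exact MeasurableSet.iUnion fun j => hMm _ _
  set u : ℕ → B → E := fun n => S.piecewise (fun b => e (J n b)) fun _ => e 0 with hu
  have hum : ∀ n, Measurable (u n) := fun n =>
    Measurable.piecewise hSm ((measurable_from_nat (f := e)).comp (hJm n)) measurable_const
  have hlim : ∀ b, ∃ x, Filter.Tendsto (fun n => u n b) Filter.atTop (nhds x) := by
    intro b
    by_cases hb : b ∈ S
    · have : CauchySeq fun n => e (J n b) :=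
        cauchySeq_of_le_geometric_two (C := 4) fun n => (inv b hb n).2.1
      obtain ⟨x, hx⟩ := cauchySeq_tendsto_of_complete this
      exact ⟨x, by simpa [hu, Set.piecewise_eq_of_mem _ _ _ hb] using hx⟩
    · exact ⟨e 0, by simpa [hu, Set.piecewise_eq_of_notMem _ _ _ hb] using tendsto_const_nhds⟩
  choose g hg using hlim
  refine ⟨g, measurable_of_tendsto_metrizable hum (tendsto_pi_nhds.2 hg), fun b hb => ?_⟩
  have hmem : b ∈ S := hb
  have hgb : Filter.Tendsto (fun n => e (J n b)) Filter.atTop (nhds (g b)) := by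
    simpa [hu, Set.piecewise_eq_of_mem _ _ _ hmem] using hg b
  choose x hx hx0 using fun n => (inv b hb n).1
  have hxg : Filter.Tendsto x Filter.atTop (nhds (g b)) := by
    refine (tendsto_iff_of_dist ?_).2 hgb
    refine squeeze_zero (fun n => dist_nonneg) (fun n => Metric.mem_closedBall.1 (hx n)) ?_
    simpa using tendsto_pow_atTop_nhds_zero_of_lt_one (r := (1 / 2 : ℝ)) (by norm_num) (by norm_num)
  have := ((hc b).tendsto (g b)).comp hxg
  exact tendsto_nhds_unique this (by simp [Function.comp_def, hx0])

end Selection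

section GaussWeight

open scoped Matrix

variable {ι : Type*} [Fintype ι]

/-- The weight `exp(-ξ · x - |x|²)`. -/
noncomputable def gaussWeight (ξ x : ι → ℝ) : ℝ := Real.exp (-(ξ ⬝ᵥ x) - x ⬝ᵥ x)

lemma gaussWeight_pos (ξ x : ι → ℝ) : 0 < gaussWeight ξ x := Real.exp_pos _

lemma continuous_gaussWeight : Continuous fun z : (ι → ℝ) × (ι → ℝ) => gaussWeight z.1 z.2 := by
  unfold gaussWeight dotProduct
  fun_prop

lemma exp_mul_gaussWeight_le {ξ : ι → ℝ} {R c s : ℝ} (hξ : ∀ j, |ξ j| ≤ R) (hc : 0 ≤ c)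
    (x : ι → ℝ) (hs : s ≤ ∑ j, |x j|) :
    Real.exp (c * s) * gaussWeight ξ x ≤ Real.exp (∑ _j : ι, (R + c) ^ 2 / 4) := by
  rw [gaussWeight, ← Real.exp_add, Real.exp_le_exp]
  have h1 : c * s ≤ ∑ j, c * |x j| := by
    rw [← Finset.mul_sum]
    exact mul_le_mul_of_nonneg_left hs hc
  have h2 : -(ξ ⬝ᵥ x) - x ⬝ᵥ x = ∑ j, (-(ξ j * x j) - x j * x j) := by
    rw [Finset.sum_sub_distrib, Finset.sum_neg_distrib]; rfl
  rw [h2]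
  refine (add_le_add_left h1 _).trans ?_
  rw [← Finset.sum_add_distrib]
  refine Finset.sum_le_sum fun j _ => ?_
  have h3 : -(ξ j * x j) ≤ R * |x j| := by
    refine (neg_le_abs _).trans ?_
    rw [abs_mul]
    exact mul_le_mul_of_nonneg_right (hξ j) (abs_nonneg _)
  nlinarith [sq_nonneg (|x j| - (R + c) / 2), abs_mul_abs_self (x j)]

variable {μ : Measure (ι → ℝ)} [IsFiniteMeasure μ]

lemma abs_mul_gaussWeight_le {g : (ι → ℝ) → ℝ} (hg : ∀ x, |g x| ≤ Real.exp (∑ j, |x j|))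
    {ξ : ι → ℝ} {R : ℝ} (hξ : ∀ j, |ξ j| ≤ R) (x : ι → ℝ) :
    ‖g x * gaussWeight ξ x‖ ≤ Real.exp (∑ _j : ι, (R + 1) ^ 2 / 4) := by
  rw [Real.norm_eq_abs, abs_mul, abs_of_pos (gaussWeight_pos ξ x)]
  refine le_trans ?_ (exp_mul_gaussWeight_le hξ zero_le_one x le_rfl)
  rw [one_mul]
  exact mul_le_mul_of_nonneg_right (hg x) (gaussWeight_pos _ _).le

lemma measurable_mul_gaussWeight {g : (ι → ℝ) → ℝ} (hgm : Measurable g) (ξ : ι → ℝ) :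
    Measurable fun x => g x * gaussWeight ξ x :=
  hgm.mul (continuous_gaussWeight.comp (continuous_const.prodMk continuous_id)).measurable

lemma integrable_mul_gaussWeight {g : (ι → ℝ) → ℝ} (hgm : Measurable g)
    (hg : ∀ x, |g x| ≤ Real.exp (∑ j, |x j|)) (ξ : ι → ℝ) :
    Integrable (fun x => g x * gaussWeight ξ x) μ :=
  Integrable.of_bound (measurable_mul_gaussWeight hgm ξ).aestronglyMeasurable _
    (Filter.Eventually.of_forall
      (abs_mul_gaussWeight_le hg (R := ‖ξ‖) fun j => norm_le_pi_norm ξ j))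

lemma continuous_integral_mul_gaussWeight {g : (ι → ℝ) → ℝ} (hgm : Measurable g)
    (hg : ∀ x, |g x| ≤ Real.exp (∑ j, |x j|)) :
    Continuous fun ξ => ∫ x, g x * gaussWeight ξ x ∂μ := by
  rw [continuous_iff_continuousAt]
  intro ξ
  refine continuousAt_of_dominated
    (bound := fun _ => Real.exp (∑ _j : ι, (‖ξ‖ + 1 + 1) ^ 2 / 4))
    (Filter.Eventually.of_forall fun ζ => (measurable_mul_gaussWeight hgm ζ).aestronglyMeasurable)
    ?_ (integrable_const _) (Filter.Eventually.of_forall fun x => ?_)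
  · filter_upwards [Metric.ball_mem_nhds ξ one_pos] with ζ hζ
    refine Filter.Eventually.of_forall (abs_mul_gaussWeight_le hg fun j => ?_)
    have h1 : ‖ζ‖ ≤ ‖ξ‖ + 1 := by
      have := norm_sub_norm_le ζ ξ
      rw [mem_ball_iff_norm] at hζ
      linarith
    exact (norm_le_pi_norm ζ j).trans h1
  · exact (continuous_const.mul
      (continuous_gaussWeight.comp (continuous_id.prodMk continuous_const))).continuousAt

lemma abs_coord_le_exp (i : ι) (x : ι → ℝ) : |x i| ≤ Real.exp (∑ j, |x j|) := by
  have h1 : |x i| ≤ ∑ j, |x j| :=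
    Finset.single_le_sum (f := fun j => |x j|) (fun j _ => abs_nonneg _) (Finset.mem_univ i)
  have h2 := Real.add_one_le_exp (∑ j, |x j|)
  linarith

lemma abs_one_le_exp (x : ι → ℝ) : |(1 : ℝ)| ≤ Real.exp (∑ j, |x j|) := by
  rw [abs_one]
  exact Real.one_le_exp (Finset.sum_nonneg fun j _ => abs_nonneg _)

lemma norm_sq_le_dotProduct_self (ξ : ι → ℝ) : ‖ξ‖ ^ 2 ≤ ξ ⬝ᵥ ξ := by
  have h0 : 0 ≤ ξ ⬝ᵥ ξ := Finset.sum_nonneg fun j _ => mul_self_nonneg _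
  have : ‖ξ‖ ≤ Real.sqrt (ξ ⬝ᵥ ξ) := by
    rw [pi_norm_le_iff_of_nonneg (Real.sqrt_nonneg _)]
    intro j
    rw [Real.norm_eq_abs]
    refine Real.abs_le_sqrt ?_
    rw [sq]
    exact Finset.single_le_sum (f := fun j => ξ j * ξ j) (fun j _ => mul_self_nonneg _)
      (Finset.mem_univ j)
  calc ‖ξ‖ ^ 2 ≤ Real.sqrt (ξ ⬝ᵥ ξ) ^ 2 := by gcongr
    _ = ξ ⬝ᵥ ξ := Real.sq_sqrt h0

lemma hasDerivAt_integral_gaussWeight [DecidableEq ι] (ξ : ι → ℝ) (i : ι) :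
    HasDerivAt (fun s : ℝ => ∫ x, gaussWeight (ξ + s • Pi.single i 1) x ∂μ)
      (-∫ x, x i * gaussWeight ξ x ∂μ) 0 := by
  have hw : ∀ (s : ℝ) (x : ι → ℝ), gaussWeight (ξ + s • Pi.single i 1) x =
      Real.exp (-(s * x i)) * gaussWeight ξ x := by
    intro s x
    rw [gaussWeight, gaussWeight, ← Real.exp_add, add_dotProduct, smul_dotProduct,
      single_one_dotProduct, smul_eq_mul]
    congr 1
    ring
  simp only [hw]
  have h := hasDerivAt_integral_of_dominated_loc_of_deriv_le (μ := μ) (𝕜 := ℝ) (x₀ := 0)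
    (F := fun s x => Real.exp (-(s * x i)) * gaussWeight ξ x)
    (F' := fun s x => Real.exp (-(s * x i)) * (-(1 * x i)) * gaussWeight ξ x)
    (bound := fun _ => Real.exp (∑ _j : ι, (‖ξ‖ + 2) ^ 2 / 4))
    (s := Metric.ball 0 1) (Metric.ball_mem_nhds _ one_pos)
    (Filter.Eventually.of_forall fun s =>
      (measurable_mul_gaussWeight (by fun_prop) ξ).aestronglyMeasurable)
    (by simpa using integrable_mul_gaussWeight (μ := μ) measurable_const abs_one_le_exp ξ)
    (measurable_mul_gaussWeight (g := fun x => Real.exp (-(0 * x i)) * (-(1 * x i)))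
      (by fun_prop) ξ).aestronglyMeasurable
    (Filter.Eventually.of_forall fun x s hs => ?_) (integrable_const _)
    (Filter.Eventually.of_forall fun x s _ => ?_)
  · have h2 := h.2
    simp only [zero_mul, neg_zero, Real.exp_zero, one_mul] at h2
    rw [← integral_neg]
    simpa using h2
  · rw [Real.norm_eq_abs, abs_mul, abs_of_pos (gaussWeight_pos ξ x)]
    refine le_trans ?_ (exp_mul_gaussWeight_le (s := |x i|) (c := 2)
      (fun j => norm_le_pi_norm ξ j) two_pos.le x
      (Finset.single_le_sum (f := fun j => |x j|) (fun j _ => abs_nonneg _) (Finset.mem_univ i)))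
    refine mul_le_mul_of_nonneg_right ?_ (gaussWeight_pos _ _).le
    rw [abs_mul, Real.abs_exp, one_mul, abs_neg, two_mul, Real.exp_add]
    refine mul_le_mul ?_ ?_ (abs_nonneg _) (Real.exp_pos _).le
    · rw [Real.exp_le_exp]
      refine (neg_le_abs _).trans ?_
      rw [abs_mul]
      have : |s| < 1 := by simpa using hs
      nlinarith [abs_nonneg (x i)]
    · linarith [Real.add_one_le_exp |x i|]
  · exact (((hasDerivAt_id s).mul_const (x i)).neg.exp).mul_const _

lemma exists_regularized_minimizer {ε : ℝ} (hε : 0 < ε) :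
    ∃ ξ : ι → ℝ, ∫ x, gaussWeight ξ x ∂μ ≤ ∫ x, gaussWeight 0 x ∂μ ∧
      ∀ i, ∫ x, x i * gaussWeight ξ x ∂μ = 2 * ε * ξ i := by
  classical
  set F : (ι → ℝ) → ℝ := fun ξ => ∫ x, gaussWeight ξ x ∂μ with hF
  have hFc : Continuous F := by
    simpa using continuous_integral_mul_gaussWeight (μ := μ) measurable_const abs_one_le_exp
  have hF0 : ∀ ξ, 0 ≤ F ξ := fun ξ => integral_nonneg fun x => (gaussWeight_pos ξ x).le
  have hdc : Continuous fun ξ : ι → ℝ => ξ ⬝ᵥ ξ := by unfold dotProduct; fun_prop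
  have hcoer : Filter.Tendsto (fun ξ => F ξ + ε * (ξ ⬝ᵥ ξ)) (Filter.cocompact _) Filter.atTop := by
    refine Filter.tendsto_atTop_mono (f := fun ξ => ε * ‖ξ‖ ^ 2) (fun ξ => ?_) ?_
    · have := mul_le_mul_of_nonneg_left (norm_sq_le_dotProduct_self ξ) hε.le
      linarith [hF0 ξ]
    · exact ((Filter.tendsto_pow_atTop two_ne_zero).comp
        (tendsto_norm_cocompact_atTop (E := ι → ℝ))).const_mul_atTop hε
  obtain ⟨ξ, hξ⟩ : ∃ ξ, ∀ ζ, F ξ + ε * (ξ ⬝ᵥ ξ) ≤ F ζ + ε * (ζ ⬝ᵥ ζ) :=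
    Continuous.exists_forall_le (hFc.add (hdc.const_mul ε)) hcoer
  refine ⟨ξ, ?_, fun i => ?_⟩
  · have h1 := hξ 0
    have h2 := mul_nonneg hε.le ((sq_nonneg _).trans (norm_sq_le_dotProduct_self ξ))
    simp only [dotProduct_zero, mul_zero, add_zero] at h1
    change F ξ ≤ F 0
    linarith
  · have hd1 := hasDerivAt_integral_gaussWeight (μ := μ) ξ i
    have hd2 : HasDerivAt (fun s : ℝ => ε * (ξ ⬝ᵥ ξ + s * (2 * ξ i) + s ^ 2))
        (ε * (2 * ξ i)) 0 := by
      have h := ((((hasDerivAt_id (0 : ℝ)).mul_const (2 * ξ i)).const_add (ξ ⬝ᵥ ξ)).add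
        ((hasDerivAt_id (0 : ℝ)).pow 2)).const_mul ε
      refine h.congr_deriv ?_
      simp
    have hmin : IsLocalMin (fun s : ℝ => (∫ x, gaussWeight (ξ + s • Pi.single i 1) x ∂μ) +
        ε * (ξ ⬝ᵥ ξ + s * (2 * ξ i) + s ^ 2)) 0 := by
      refine Filter.Eventually.of_forall fun s => ?_
      have h := hξ (ξ + s • Pi.single i 1)
      have e1 : (ξ + s • Pi.single i 1) ⬝ᵥ (ξ + s • Pi.single i 1) =
          ξ ⬝ᵥ ξ + s * (2 * ξ i) + s ^ 2 := by
        simp only [add_dotProduct, dotProduct_add, smul_dotProduct, dotProduct_smul,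
          single_one_dotProduct, dotProduct_single_one, smul_eq_mul, Pi.add_apply, Pi.smul_apply,
          Pi.single_eq_same]
        ring
      rw [e1] at h
      simpa [hF] using h
    have := hmin.hasDerivAt_eq_zero (hd1.add hd2)
    linarith

/-- A one-period market without arbitrage admits an exponential martingale density. -/
theorem exists_integral_gaussWeight_eq_zero
    (hNA : ∀ v : ι → ℝ, (∀ᵐ x ∂μ, 0 ≤ v ⬝ᵥ x) → ∀ᵐ x ∂μ, v ⬝ᵥ x = 0) :
    ∃ ξ : ι → ℝ, ∀ i, ∫ x, x i * gaussWeight ξ x ∂μ = 0 := by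
  have hε : ∀ n : ℕ, (0 : ℝ) < 1 / ((n : ℝ) + 1) := fun n => Nat.one_div_pos_of_nat
  choose ξ hξF hξ using fun n : ℕ => exists_regularized_minimizer (μ := μ) (hε n)
  have hcont : ∀ i : ι, Continuous fun ζ => ∫ x, x i * gaussWeight ζ x ∂μ := fun i =>
    continuous_integral_mul_gaussWeight (measurable_pi_apply i) (abs_coord_le_exp i)
  by_cases hb : ∃ R, ∃ᶠ n in Filter.atTop, ‖ξ n‖ ≤ R
  · obtain ⟨R, hR⟩ := hb
    obtain ⟨a, -, φ, hφ, ha⟩ := tendsto_subseq_of_frequently_bounded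
      (Metric.isBounded_closedBall (x := (0 : ι → ℝ)) (r := R))
      (hR.mono fun n hn => by simpa using hn)
    refine ⟨a, fun i => ?_⟩
    have h1 := ((hcont i).tendsto a).comp ha
    have h2 : Filter.Tendsto (fun n => 2 * (1 / (((φ n : ℕ) : ℝ) + 1)) * ξ (φ n) i)
        Filter.atTop (nhds (2 * 0 * a i)) :=
      ((tendsto_one_div_add_atTop_nhds_zero_nat.comp hφ.tendsto_atTop).const_mul 2).mul
        ((tendsto_pi_nhds.1 ha) i)
    rw [mul_zero, zero_mul] at h2
    refine tendsto_nhds_unique h1 (h2.congr fun n => ?_)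
    exact (hξ (φ n) i).symm
  · exfalso
    push Not at hb
    have hinf : Filter.Tendsto (fun n => ‖ξ n‖) Filter.atTop Filter.atTop := by
      refine Filter.tendsto_atTop.2 fun R => ?_
      have := hb R
      filter_upwards [this] with n hn using hn.le
    obtain ⟨v, -, φ, hφ, hv⟩ := tendsto_subseq_of_bounded
      (Metric.isBounded_closedBall (x := (0 : ι → ℝ)) (r := 1))
      (x := fun n => ‖ξ n‖⁻¹ • ξ n) (fun n => by
        rw [mem_closedBall_zero_iff, norm_smul, norm_inv, norm_norm]
        exact inv_mul_le_one)
    have hinf' : Filter.Tendsto (fun n => ‖ξ (φ n)‖) Filter.atTop Filter.atTop :=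
      hinf.comp hφ.tendsto_atTop
    have hv1 : ‖v‖ = 1 := by
      refine tendsto_nhds_unique hv.norm (tendsto_const_nhds.congr' ?_)
      filter_upwards [hinf'.eventually_gt_atTop 0] with n hn
      simp only [Function.comp_def, norm_smul, norm_inv, norm_norm]
      rw [inv_mul_cancel₀ hn.ne']
    have hdot : ∀ x : ι → ℝ, Filter.Tendsto (fun n => ‖ξ (φ n)‖⁻¹ * (ξ (φ n) ⬝ᵥ x)) Filter.atTop
        (nhds (v ⬝ᵥ x)) := by
      intro x
      have hc : Continuous fun u : ι → ℝ => u ⬝ᵥ x := by unfold dotProduct; fun_prop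
      simpa [Function.comp_def, smul_dotProduct] using (hc.tendsto v).comp hv
    have hge : ∀ᵐ x ∂μ, 0 ≤ v ⬝ᵥ x := by
      have hmeas : ∀ n, Measurable fun x => ENNReal.ofReal (gaussWeight (ξ (φ n)) x) := fun n => by
        simpa using (measurable_mul_gaussWeight measurable_const (g := fun _ => 1)
          (ξ (φ n))).ennreal_ofReal
      have hle : ∀ n, ∫⁻ x, ENNReal.ofReal (gaussWeight (ξ (φ n)) x) ∂μ ≤
          ENNReal.ofReal (∫ x, gaussWeight 0 x ∂μ) := fun n => by
        rw [← ofReal_integral_eq_lintegral_ofReal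
          (by simpa using integrable_mul_gaussWeight (μ := μ) measurable_const abs_one_le_exp _)
          (Filter.Eventually.of_forall fun x => (gaussWeight_pos _ x).le)]
        exact ENNReal.ofReal_le_ofReal (hξF _)
      have hfatou := (lintegral_liminf_le (μ := μ) (u := Filter.atTop) hmeas).trans
        (Filter.liminf_le_of_frequently_le' (Filter.Frequently.of_forall hle))
      have hfin := ae_lt_top (Measurable.liminf hmeas) (hfatou.trans_lt ENNReal.ofReal_lt_top).ne
      filter_upwards [hfin] with x hx
      by_contra hneg
      push Not at hneg
      refine hx.ne (Filter.Tendsto.liminf_eq ?_)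
      refine ENNReal.tendsto_ofReal_atTop.comp (Real.tendsto_exp_atTop.comp ?_)
      refine Filter.tendsto_atTop_add_const_right _ _ ?_
      have h1 := (hinf'.atTop_mul_neg hneg (hdot x))
      refine (Filter.tendsto_neg_atBot_atTop.comp h1).congr' ?_
      filter_upwards [hinf'.eventually_gt_atTop 0] with n hn
      simp only [Function.comp_def]
      rw [mul_inv_cancel_left₀ hn.ne']
    have hz := hNA v hge
    have horth : ∀ n, v ⬝ᵥ ξ n = 0 := by
      intro n
      have h1 : ∫ x, (v ⬝ᵥ x) * gaussWeight (ξ n) x ∂μ = 0 := by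
        rw [integral_congr_ae (g := fun _ => (0 : ℝ))]
        · simp
        · filter_upwards [hz] with x hx
          rw [hx, zero_mul]
      have h2 : ∫ x, (v ⬝ᵥ x) * gaussWeight (ξ n) x ∂μ =
          ∑ i, v i * (2 * (1 / ((n : ℝ) + 1)) * ξ n i) := by
        simp only [dotProduct, Finset.sum_mul]
        rw [integral_finsetSum]
        · refine Finset.sum_congr rfl fun i _ => ?_
          rw [← hξ n i, ← integral_const_mul]
          simp only [mul_assoc]
        · intro i _
          simpa [mul_assoc] using (integrable_mul_gaussWeight (μ := μ) (measurable_pi_apply i)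
            (abs_coord_le_exp i) (ξ n)).const_mul (v i)
      have h3 : ∑ i, v i * (2 * (1 / ((n : ℝ) + 1)) * ξ n i) =
          2 * (1 / ((n : ℝ) + 1)) * (v ⬝ᵥ ξ n) := by
        rw [dotProduct, Finset.mul_sum]
        exact Finset.sum_congr rfl fun i _ => by ring
      rw [h2, h3] at h1
      exact (mul_eq_zero.1 h1).resolve_left (mul_pos two_pos (hε n)).ne'
    have hvv : v ⬝ᵥ v = 0 := by
      refine tendsto_nhds_unique (hdot v) (tendsto_const_nhds.congr fun n => ?_)
      rw [dotProduct_comm, horth, mul_zero]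
    have := norm_sq_le_dotProduct_self v
    rw [hv1, hvv] at this
    norm_num at this

end GaussWeight

section OnePeriod

open scoped Matrix

variable {Ω B S ι : Type*} [MeasurableSpace Ω] [MeasurableSpace B]
  [MeasurableSpace S] [StandardBorelSpace S] [Nonempty S] [Fintype ι]
  {Q : Measure Ω} [IsFiniteMeasure Q] {π : Ω → B}

lemma ae_iff_ae_condDistrib {U : Ω → S} (hπ : Measurable π) (hU : Measurable U) {p : B × S → Prop}
    (hp : MeasurableSet {z | p z}) :
    (∀ᵐ ω ∂Q, p (π ω, U ω)) ↔ ∀ᵐ b ∂(Q.map π), ∀ᵐ s ∂(condDistrib U π Q b), p (b, s) := by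
  rw [← Measure.ae_compProd_iff hp, compProd_map_condDistrib hU.aemeasurable,
    ae_map_iff (hπ.prodMk hU).aemeasurable hp]

lemma setIntegral_preimage_eq_zero {U : Ω → S} (hπ : Measurable π) (hU : Measurable U)
    {f : B × S → ℝ} (hf : Measurable f) (hint : Integrable (fun ω => f (π ω, U ω)) Q)
    (h : ∀ᵐ b ∂(Q.map π), ∫ s, f (b, s) ∂(condDistrib U π Q b) = 0) {A : Set B}
    (hA : MeasurableSet A) : ∫ ω in π ⁻¹' A, f (π ω, U ω) ∂Q = 0 := by
  have hint' : Integrable f (Q.map π ⊗ₘ condDistrib U π Q) := by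
    rw [compProd_map_condDistrib hU.aemeasurable]
    exact (integrable_map_measure hf.aestronglyMeasurable (hπ.prodMk hU).aemeasurable).2 hint
  have h1 := Measure.setIntegral_compProd hA MeasurableSet.univ hint'.integrableOn
  rw [compProd_map_condDistrib hU.aemeasurable,
    setIntegral_map (hA.prod MeasurableSet.univ) hf.aestronglyMeasurable
      (hπ.prodMk hU).aemeasurable] at h1
  have h2 : (fun a => (π a, U a)) ⁻¹' A ×ˢ Set.univ = π ⁻¹' A := by ext; simp
  rw [h2] at h1
  rw [h1, setIntegral_congr_ae (g := fun _ => (0 : ℝ)) hA]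
  · simp
  · filter_upwards [h] with b hb _
    simpa using hb

lemma measurable_dotProduct {α : Type*} [MeasurableSpace α] {f g : α → ι → ℝ} (hf : Measurable f)
    (hg : Measurable g) : Measurable fun a => f a ⬝ᵥ g a := by
  unfold dotProduct
  exact Finset.measurable_sum _ fun i _ =>
    ((measurable_pi_apply i).comp hf).mul ((measurable_pi_apply i).comp hg)

lemma dotProduct_self_nonneg' (x : ι → ℝ) : 0 ≤ x ⬝ᵥ x :=
  Finset.sum_nonneg fun _ _ => mul_self_nonneg _

lemma abs_coord_le_one_add (x : ι → ℝ) (i : ι) : |x i| ≤ 1 + x ⬝ᵥ x := by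
  have h1 : x i * x i ≤ x ⬝ᵥ x :=
    Finset.single_le_sum (f := fun j => x j * x j) (fun j _ => mul_self_nonneg _)
      (Finset.mem_univ i)
  nlinarith [sq_nonneg (|x i| - 1), abs_mul_abs_self (x i), abs_nonneg (x i)]

lemma integrable_coord_div (μ : Measure (ι → ℝ)) [IsFiniteMeasure μ] (i : ι) :
    Integrable (fun x => x i / (1 + x ⬝ᵥ x)) μ := by
  refine Integrable.of_bound (C := 1) ?_ (Filter.Eventually.of_forall fun x => ?_)
  · exact ((measurable_pi_apply i).div
      ((measurable_dotProduct measurable_id measurable_id).const_add 1)).aestronglyMeasurable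
  · have h0 := dotProduct_self_nonneg' x
    rw [Real.norm_eq_abs, abs_div, abs_of_pos (by linarith : 0 < 1 + x ⬝ᵥ x),
      div_le_one (by linarith)]
    exact abs_coord_le_one_add x i

lemma dotProduct_div_eq_sum (v x : ι → ℝ) :
    (v ⬝ᵥ x) / (1 + x ⬝ᵥ x) = ∑ i, v i * (x i / (1 + x ⬝ᵥ x)) := by
  rw [dotProduct, Finset.sum_div]
  exact Finset.sum_congr rfl fun i _ => by ring

lemma integral_dotProduct_div (μ : Measure (ι → ℝ)) [IsFiniteMeasure μ] (v : ι → ℝ) :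
    ∫ x, (v ⬝ᵥ x) / (1 + x ⬝ᵥ x) ∂μ = ∑ i, v i * ∫ x, x i / (1 + x ⬝ᵥ x) ∂μ := by
  simp only [dotProduct_div_eq_sum, ← integral_const_mul]
  exact integral_finsetSum _ fun i _ => (integrable_coord_div μ i).const_mul _

/-- Conditionally on the information at the beginning of the period, an arbitrage-free one-period
market is arbitrage-free. -/
lemma condDistrib_arbitrageFree {U : Ω → ι → ℝ} (hπ : Measurable π) (hU : Measurable U)
    (hNA : ∀ ξ : B → ι → ℝ, Measurable ξ → (∀ᵐ ω ∂Q, 0 ≤ ξ (π ω) ⬝ᵥ U ω) →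
      ∀ᵐ ω ∂Q, ξ (π ω) ⬝ᵥ U ω = 0) :
    ∀ᵐ b ∂(Q.map π), ∀ v : ι → ℝ, (∀ᵐ x ∂(condDistrib U π Q b), 0 ≤ v ⬝ᵥ x) →
      ∀ᵐ x ∂(condDistrib U π Q b), v ⬝ᵥ x = 0 := by
  classical
  set κ := condDistrib U π Q
  set l : (ι → ℝ) → (ι → ℝ) → ℝ := fun v x => min 1 (max 0 (-(v ⬝ᵥ x))) with hl
  have hl0 : ∀ v x, 0 ≤ l v x := fun v x => le_min zero_le_one (le_max_left _ _)
  have hl1 : ∀ v x, ‖l v x‖ ≤ 1 := fun v x => by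
    rw [Real.norm_of_nonneg (hl0 v x)]; exact min_le_left _ _
  have hlc : Continuous fun z : (ι → ℝ) × (ι → ℝ) => l z.1 z.2 := by
    simp only [hl]
    unfold dotProduct
    fun_prop
  set h : B → (ι → ℝ) → ℝ := fun b v =>
    (∫ x, l v x ∂(κ b)) + |(∑ i, v i * ∫ x, x i / (1 + x ⬝ᵥ x) ∂(κ b)) - 1| with hh
  have hmi : ∀ i, Measurable fun b => ∫ x, x i / (1 + x ⬝ᵥ x) ∂(κ b) := fun i => by
    refine (StronglyMeasurable.integral_kernel_prod_right (κ := κ)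
      (f := fun _ x => x i / (1 + x ⬝ᵥ x)) ?_).measurable
    exact (((measurable_pi_apply i).comp measurable_snd).div
      ((measurable_dotProduct measurable_snd measurable_snd).const_add 1)).stronglyMeasurable
  have hmg : ∀ g : B → ι → ℝ, Measurable g → Measurable fun b => h b (g b) := by
    intro g hg
    refine Measurable.add ?_ ?_
    · refine (StronglyMeasurable.integral_kernel_prod_right (κ := κ)
        (f := fun b x => l (g b) x) ?_).measurable
      exact (hlc.measurable.comp ((hg.comp measurable_fst).prodMk
        measurable_snd)).stronglyMeasurable
    · have hs : Measurable fun b => (∑ i, g b i * ∫ x, x i / (1 + x ⬝ᵥ x) ∂(κ b)) - 1 :=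
        (Finset.measurable_sum _ fun i _ =>
          ((measurable_pi_apply i).comp hg).mul (hmi i)).sub_const 1
      exact hs.norm
  have hcont : ∀ b, Continuous (h b) := by
    intro b
    refine Continuous.add ?_ (by fun_prop)
    refine continuous_of_dominated (bound := fun _ => 1)
      (fun v => (hlc.comp (continuous_const.prodMk continuous_id)).aestronglyMeasurable)
      (fun v => Filter.Eventually.of_forall (hl1 v)) (integrable_const _)
      (Filter.Eventually.of_forall fun x => hlc.comp (continuous_id.prodMk continuous_const))
  have h0 : ∀ b v, 0 ≤ h b v := fun b v =>
    add_nonneg (integral_nonneg (hl0 v)) (abs_nonneg _)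
  have hzero : ∀ b v, h b v = 0 → (∀ᵐ x ∂(κ b), 0 ≤ v ⬝ᵥ x) ∧
      ∫ x, (v ⬝ᵥ x) / (1 + x ⬝ᵥ x) ∂(κ b) = 1 := by
    intro b v hbv
    have h1 : 0 ≤ ∫ x, l v x ∂(κ b) := integral_nonneg (hl0 v)
    have h2 := abs_nonneg ((∑ i, v i * ∫ x, x i / (1 + x ⬝ᵥ x) ∂(κ b)) - 1)
    simp only [hh] at hbv
    refine ⟨?_, ?_⟩
    · have h3 : ∫ x, l v x ∂(κ b) = 0 := by linarith
      rw [integral_eq_zero_iff_of_nonneg (hl0 v) (Integrable.of_bound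
        (hlc.comp (continuous_const.prodMk continuous_id)).aestronglyMeasurable 1
        (Filter.Eventually.of_forall (hl1 v)))] at h3
      filter_upwards [h3] with x hx
      by_contra hneg
      push Not at hneg
      have : 0 < l v x := lt_min one_pos (lt_max_of_lt_right (by linarith))
      exact this.ne' hx
    · rw [integral_dotProduct_div]
      have h3 := abs_eq_zero.1 (by linarith :
        |(∑ i, v i * ∫ x, x i / (1 + x ⬝ᵥ x) ∂(κ b)) - 1| = 0)
      linarith
  obtain ⟨g, hgm, hg⟩ := exists_measurable_zero (h := h)
    (fun v => hmg (fun _ => v) measurable_const) hcont h0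
  set g' : B → ι → ℝ := fun b => if h b (g b) = 0 then g b else 0 with hg'
  have hg'm : Measurable g' :=
    Measurable.ite (measurableSet_eq_fun (hmg g hgm) measurable_const) hgm measurable_const
  have hmd : Measurable fun z : B × (ι → ℝ) => g' z.1 ⬝ᵥ z.2 :=
    measurable_dotProduct (hg'm.comp measurable_fst) measurable_snd
  have hNA' := hNA g' hg'm (by
    rw [ae_iff_ae_condDistrib hπ hU (p := fun z => 0 ≤ g' z.1 ⬝ᵥ z.2)
      (measurableSet_le measurable_const hmd)]
    refine Filter.Eventually.of_forall fun b => ?_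
    by_cases hb : h b (g b) = 0
    · simpa only [hg', if_pos hb] using (hzero b _ hb).1
    · simp [hg', if_neg hb])
  rw [ae_iff_ae_condDistrib hπ hU (p := fun z => g' z.1 ⬝ᵥ z.2 = 0)
      (measurableSet_eq_fun hmd measurable_const)] at hNA'
  filter_upwards [hNA'] with b hb v hv
  by_contra hne
  have hnn : 0 ≤ᵐ[κ b] fun x => (v ⬝ᵥ x) / (1 + x ⬝ᵥ x) := by
    filter_upwards [hv] with x hx
    exact div_nonneg hx (by linarith [dotProduct_self_nonneg' x])
  have hintv : Integrable (fun x => (v ⬝ᵥ x) / (1 + x ⬝ᵥ x)) (κ b) := by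
    simp only [dotProduct_div_eq_sum]
    exact integrable_finsetSum _ fun i _ => (integrable_coord_div (κ b) i).const_mul _
  have hpos : 0 < ∫ x, (v ⬝ᵥ x) / (1 + x ⬝ᵥ x) ∂(κ b) := by
    refine lt_of_le_of_ne (integral_nonneg_of_ae hnn) fun he => hne ?_
    have := (integral_eq_zero_iff_of_nonneg_ae hnn hintv).1 he.symm
    filter_upwards [this] with x hx
    have h1 := dotProduct_self_nonneg' x
    exact (div_eq_zero_iff.1 hx).resolve_right (by linarith)
  set c := ∫ x, (v ⬝ᵥ x) / (1 + x ⬝ᵥ x) ∂(κ b) with hc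
  have hex : ∃ u, h b u = 0 := by
    refine ⟨c⁻¹ • v, ?_⟩
    have e1 : ∫ x, l (c⁻¹ • v) x ∂(κ b) = 0 := by
      rw [integral_congr_ae (g := fun _ => (0 : ℝ))]
      · simp
      · filter_upwards [hv] with x hx
        have : 0 ≤ (c⁻¹ • v) ⬝ᵥ x := by
          rw [smul_dotProduct, smul_eq_mul]
          exact mul_nonneg (inv_nonneg.2 hpos.le) hx
        simp only [hl]
        rw [max_eq_left (by linarith)]
        simp
    have e2 : ∑ i, (c⁻¹ • v) i * ∫ x, x i / (1 + x ⬝ᵥ x) ∂(κ b) = 1 := by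
      simp only [Pi.smul_apply, smul_eq_mul, mul_assoc]
      rw [← Finset.mul_sum, ← integral_dotProduct_div, ← hc, inv_mul_cancel₀ hpos.ne']
    simp only [hh]
    rw [e1, e2]
    simp
  have hgb := hg b hex
  have h1 := (hzero b _ hgb).2
  simp only [hg', if_pos hgb] at hb
  rw [integral_congr_ae (g := fun _ => (0 : ℝ))] at h1
  · simp at h1
  · filter_upwards [hb] with x hx
    rw [hx, zero_div]

lemma gaussWeight_mul_exp_le_one (ξ x : ι → ℝ) :
    gaussWeight ξ x * Real.exp (-(ξ ⬝ᵥ ξ) / 4) ≤ 1 := by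
  rw [gaussWeight, ← Real.exp_add, Real.exp_le_one_iff]
  have h : 0 ≤ (x + (1 / 2 : ℝ) • ξ) ⬝ᵥ (x + (1 / 2 : ℝ) • ξ) := dotProduct_self_nonneg' _
  simp only [add_dotProduct, dotProduct_add, smul_dotProduct, dotProduct_smul, smul_eq_mul,
    dotProduct_comm x ξ] at h
  linarith

/-- The one-period Dalang–Morton–Willinger theorem. -/
theorem exists_oneperiod_martingale_density {U : Ω → ι → ℝ} (hπ : Measurable π)
    (hU : Measurable U) (hint : ∀ i, Integrable (fun ω => U ω i) Q)
    (hNA : ∀ ξ : B → ι → ℝ, Measurable ξ → (∀ᵐ ω ∂Q, 0 ≤ ξ (π ω) ⬝ᵥ U ω) →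
      ∀ᵐ ω ∂Q, ξ (π ω) ⬝ᵥ U ω = 0) :
    ∃ D : B × (ι → ℝ) → ℝ, Measurable D ∧ (∀ z, 0 < D z ∧ D z ≤ 1) ∧
      ∀ i (A : Set B), MeasurableSet A → ∫ ω in π ⁻¹' A, U ω i * D (π ω, U ω) ∂Q = 0 := by
  have hcond := condDistrib_arbitrageFree hπ hU hNA
  set κ := condDistrib U π Q
  have hgi : ∀ g : B → ι → ℝ, Measurable g → ∀ i, Measurable fun b =>
      ∫ x, x i * gaussWeight (g b) x ∂(κ b) := fun g hg i => by
    refine (StronglyMeasurable.integral_kernel_prod_right (κ := κ)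
      (f := fun b x => x i * gaussWeight (g b) x) ?_).measurable
    exact (((measurable_pi_apply i).comp measurable_snd).mul (continuous_gaussWeight.measurable.comp
      ((hg.comp measurable_fst).prodMk measurable_snd))).stronglyMeasurable
  obtain ⟨g, hgm, hg⟩ := exists_measurable_zero
    (h := fun b (ξ : ι → ℝ) => ∑ i, |∫ x, x i * gaussWeight ξ x ∂(κ b)|)
    (fun ξ => Finset.measurable_sum _ fun i _ =>
      measurable_norm.comp (hgi (fun _ => ξ) measurable_const i))
    (fun b => continuous_finsetSum _ fun i _ =>
      (continuous_integral_mul_gaussWeight (measurable_pi_apply i) (abs_coord_le_exp i)).abs)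
    (fun b ξ => Finset.sum_nonneg fun i _ => abs_nonneg _)
  have hD : Measurable fun z : B × (ι → ℝ) =>
      gaussWeight (g z.1) z.2 * Real.exp (-(g z.1 ⬝ᵥ g z.1) / 4) :=
    (continuous_gaussWeight.measurable.comp ((hgm.comp measurable_fst).prodMk
      measurable_snd)).mul (((measurable_dotProduct (hgm.comp measurable_fst)
      (hgm.comp measurable_fst)).neg.div_const 4).exp)
  refine ⟨_, hD, fun z => ⟨mul_pos (gaussWeight_pos _ _) (Real.exp_pos _),
    gaussWeight_mul_exp_le_one _ _⟩, fun i A hA => ?_⟩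
  refine setIntegral_preimage_eq_zero hπ hU (f := fun z => z.2 i *
    (gaussWeight (g z.1) z.2 * Real.exp (-(g z.1 ⬝ᵥ g z.1) / 4)))
    (((measurable_pi_apply i).comp measurable_snd).mul hD) ?_ ?_ hA
  · refine (hint i).mul_bdd (c := 1) (hD.comp (hπ.prodMk hU)).aestronglyMeasurable
      (Filter.Eventually.of_forall fun ω => ?_)
    rw [Real.norm_of_nonneg (mul_pos (gaussWeight_pos _ _) (Real.exp_pos _)).le]
    exact gaussWeight_mul_exp_le_one _ _
  · filter_upwards [hcond] with b hb
    have hz := hg b ((exists_integral_gaussWeight_eq_zero hb).imp fun ξ hξ => by simp [hξ])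
    have hz' := abs_eq_zero.1
      ((Finset.sum_eq_zero_iff_of_nonneg fun i _ => abs_nonneg _).1 hz i (Finset.mem_univ i))
    simp only [← mul_assoc]
    rw [integral_mul_const, hz', zero_mul]

end OnePeriod

section LeastSquares

open scoped Matrix

lemma exists_residual_orthogonal {H ι : Type*} [NormedAddCommGroup H] [InnerProductSpace ℝ H]
    [Fintype ι] (f : ι → H) (y : H) : ∃ c : ι → ℝ, ∀ i, inner ℝ (f i) (y - ∑ j, c j • f j) = 0 := by
  set K := Submodule.span ℝ (Set.range f) with hK
  have : FiniteDimensional ℝ K := FiniteDimensional.span_of_finite ℝ (Set.finite_range f)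
  obtain ⟨c, hc⟩ := (Submodule.mem_span_range_iff_exists_fun ℝ).1 (K.starProjection_apply_mem y)
  refine ⟨c, fun i => ?_⟩
  rw [hc]
  exact Submodule.inner_right_of_mem_orthogonal (Submodule.subset_span (Set.mem_range_self i))
    (K.sub_starProjection_mem_orthogonal y)

/-- Normal equations of the least squares problem in `L²`. -/
lemma exists_normal_equations {α ι : Type*} [MeasurableSpace α] {μ : Measure α} [Fintype ι]
    {f : ι → α → ℝ} {y : α → ℝ} (hf : ∀ i, MemLp (f i) 2 μ) (hy : MemLp y 2 μ) :
    ∃ c : ι → ℝ, ∀ i, ∫ a, y a * f i a ∂μ = ∑ j, c j * ∫ a, f j a * f i a ∂μ := by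
  obtain ⟨c, hc⟩ := exists_residual_orthogonal (fun i => (hf i).toLp (f i)) (hy.toLp y)
  have hinner : ∀ {g h : α → ℝ} (hg : MemLp g 2 μ) (hh : MemLp h 2 μ),
      inner ℝ (hg.toLp g) (hh.toLp h) = ∫ a, h a * g a ∂μ := by
    intro g h hg hh
    rw [L2.inner_def]
    refine integral_congr_ae ?_
    filter_upwards [hg.coeFn_toLp, hh.coeFn_toLp] with a h1 h2
    rw [h1, h2]
    rfl
  refine ⟨c, fun i => ?_⟩
  have h := hc i
  rw [inner_sub_right, inner_sum, hinner (hf i) hy, sub_eq_zero] at h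
  rw [h]
  refine Finset.sum_congr rfl fun j _ => ?_
  rw [real_inner_smul_right, hinner (hf i) (hf j)]

variable {Ω B ι : Type*} [MeasurableSpace Ω] [MeasurableSpace B] [Fintype ι]
  {Q : Measure Ω} [IsFiniteMeasure Q] {π : Ω → B}

/-- The weight `1 / (1 + |x|² + y²)`. -/
noncomputable def polyWeight (z : (ι → ℝ) × ℝ) : ℝ := (1 + z.1 ⬝ᵥ z.1 + z.2 ^ 2)⁻¹

lemma polyWeight_pos (z : (ι → ℝ) × ℝ) : 0 < polyWeight z := by
  have := dotProduct_self_nonneg' z.1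
  unfold polyWeight
  positivity

lemma measurable_polyWeight : Measurable (polyWeight : (ι → ℝ) × ℝ → ℝ) := by
  unfold polyWeight
  exact (((measurable_dotProduct measurable_fst measurable_fst).const_add 1).add
    (measurable_snd.pow_const 2)).inv

lemma abs_mul_polyWeight_le {z : (ι → ℝ) × ℝ} {r : ℝ} (hr : r ≤ 1 + z.1 ⬝ᵥ z.1 + z.2 ^ 2) :
    r * polyWeight z ≤ 1 := by
  have := dotProduct_self_nonneg' z.1
  unfold polyWeight
  rw [← div_eq_mul_inv, div_le_one (by positivity)]
  exact hr

lemma coord_sq_le (z : (ι → ℝ) × ℝ) (i : ι) : z.1 i ^ 2 ≤ 1 + z.1 ⬝ᵥ z.1 + z.2 ^ 2 := by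
  have h1 : z.1 i * z.1 i ≤ z.1 ⬝ᵥ z.1 :=
    Finset.single_le_sum (f := fun j => z.1 j * z.1 j) (fun j _ => mul_self_nonneg _)
      (Finset.mem_univ i)
  nlinarith [sq_nonneg z.2]

lemma snd_sq_le (z : (ι → ℝ) × ℝ) : z.2 ^ 2 ≤ 1 + z.1 ⬝ᵥ z.1 + z.2 ^ 2 := by
  linarith [dotProduct_self_nonneg' z.1]

lemma memLp_mul_sqrt_polyWeight {μ : Measure ((ι → ℝ) × ℝ)} [IsFiniteMeasure μ]
    {f : (ι → ℝ) × ℝ → ℝ} (hf : Measurable f) (h : ∀ z, f z ^ 2 ≤ 1 + z.1 ⬝ᵥ z.1 + z.2 ^ 2) :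
    MemLp (fun z => f z * Real.sqrt (polyWeight z)) 2 μ := by
  refine MemLp.of_bound (hf.mul measurable_polyWeight.sqrt).aestronglyMeasurable 1
    (Filter.Eventually.of_forall fun z => ?_)
  rw [Real.norm_eq_abs, ← sq_le_one_iff_abs_le_one, mul_pow, Real.sq_sqrt (polyWeight_pos z).le]
  exact abs_mul_polyWeight_le (h z)

lemma integrable_mul_mul_polyWeight {μ : Measure ((ι → ℝ) × ℝ)} [IsFiniteMeasure μ]
    {f g : (ι → ℝ) × ℝ → ℝ} (hf : Measurable f) (hf2 : ∀ z, f z ^ 2 ≤ 1 + z.1 ⬝ᵥ z.1 + z.2 ^ 2)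
    (hg : Measurable g) (hg2 : ∀ z, g z ^ 2 ≤ 1 + z.1 ⬝ᵥ z.1 + z.2 ^ 2) :
    Integrable (fun z => f z * g z * polyWeight z) μ := by
  refine ((memLp_mul_sqrt_polyWeight hf hf2).integrable_mul
    (memLp_mul_sqrt_polyWeight hg hg2)).congr (Filter.Eventually.of_forall fun z => ?_)
  have := Real.mul_self_sqrt (polyWeight_pos z).le
  simp only [Pi.mul_apply]
  linear_combination (f z * g z) * this

lemma exists_weighted_normal_equations (μ : Measure ((ι → ℝ) × ℝ)) [IsFiniteMeasure μ] :
    ∃ ξ : ι → ℝ, ∀ i, ∫ z, z.2 * z.1 i * polyWeight z ∂μ =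
      ∑ j, ξ j * ∫ z, z.1 j * z.1 i * polyWeight z ∂μ := by
  obtain ⟨c, hc⟩ := exists_normal_equations (μ := μ)
    (f := fun (i : ι) z => z.1 i * Real.sqrt (polyWeight z))
    (y := fun z => z.2 * Real.sqrt (polyWeight z))
    (fun i => memLp_mul_sqrt_polyWeight (by fun_prop) fun z => coord_sq_le z i)
    (memLp_mul_sqrt_polyWeight (by fun_prop) snd_sq_le)
  have e : ∀ (a b : ℝ) (z : (ι → ℝ) × ℝ), a * Real.sqrt (polyWeight z) *
      (b * Real.sqrt (polyWeight z)) = a * b * polyWeight z := by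
    intro a b z
    linear_combination (a * b) * Real.mul_self_sqrt (polyWeight_pos z).le
  simp only [e] at hc
  exact ⟨c, hc⟩

/-- Conditional least squares regression of `y` on `x`: the (rescaled) residual `Z` is conditionally
orthogonal to `x`, and vanishes only if `y` is a conditional linear combination of `x`. -/
theorem exists_conditional_residual {x : Ω → ι → ℝ} {y : Ω → ℝ} (hπ : Measurable π)
    (hx : Measurable x) (hy : Measurable y) (hint : ∀ i, Integrable (fun ω => x ω i) Q) :
    ∃ (ξ : B → ι → ℝ) (Z : B × ((ι → ℝ) × ℝ) → ℝ), Measurable ξ ∧ Measurable Z ∧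
      (∀ z, |Z z| ≤ 1) ∧ (∀ z, Z z = 0 → z.2.2 = ξ z.1 ⬝ᵥ z.2.1) ∧
      ∀ i (A : Set B), MeasurableSet A →
        ∫ ω in π ⁻¹' A, x ω i * Z (π ω, (x ω, y ω)) ∂Q = 0 := by
  set U : Ω → (ι → ℝ) × ℝ := fun ω => (x ω, y ω) with hU
  have hUm : Measurable U := hx.prodMk hy
  set κ := condDistrib U π Q
  have hA : ∀ i j, Measurable fun b => ∫ z, z.1 j * z.1 i * polyWeight z ∂(κ b) := fun i j => by
    refine (StronglyMeasurable.integral_kernel_prod_right (κ := κ)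
      (f := fun _ z => z.1 j * z.1 i * polyWeight z) ?_).measurable
    exact (Measurable.mul (by fun_prop)
      (measurable_polyWeight.comp measurable_snd)).stronglyMeasurable
  have hb : ∀ i, Measurable fun b => ∫ z, z.2 * z.1 i * polyWeight z ∂(κ b) := fun i => by
    refine (StronglyMeasurable.integral_kernel_prod_right (κ := κ)
      (f := fun _ z => z.2 * z.1 i * polyWeight z) ?_).measurable
    exact (Measurable.mul (by fun_prop)
      (measurable_polyWeight.comp measurable_snd)).stronglyMeasurable
  obtain ⟨ξ, hξm, hξ⟩ := exists_measurable_zero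
    (h := fun b (ξ : ι → ℝ) => ∑ i, |(∫ z, z.2 * z.1 i * polyWeight z ∂(κ b)) -
      ∑ j, ξ j * ∫ z, z.1 j * z.1 i * polyWeight z ∂(κ b)|)
    (fun ξ => Finset.measurable_sum _ fun i _ => ((hb i).sub
      (Finset.measurable_sum _ fun j _ => (hA i j).const_mul (ξ j))).norm)
    (fun b => by fun_prop) (fun b ξ => Finset.sum_nonneg fun i _ => abs_nonneg _)
  have hnormal : ∀ b i, ∫ z, z.2 * z.1 i * polyWeight z ∂(κ b) =
      ∑ j, ξ b j * ∫ z, z.1 j * z.1 i * polyWeight z ∂(κ b) := by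
    intro b i
    have hz := hξ b ((exists_weighted_normal_equations (κ b)).imp fun c hc => by simp [hc])
    exact sub_eq_zero.1 (abs_eq_zero.1
      ((Finset.sum_eq_zero_iff_of_nonneg fun i _ => abs_nonneg _).1 hz i (Finset.mem_univ i)))
  have hden : ∀ b, 0 < 1 + ∑ j, |ξ b j| := fun b =>
    add_pos_of_pos_of_nonneg one_pos (Finset.sum_nonneg fun j _ => abs_nonneg _)
  set Z : B × ((ι → ℝ) × ℝ) → ℝ := fun z =>
    (z.2.2 - ξ z.1 ⬝ᵥ z.2.1) * polyWeight z.2 / (1 + ∑ j, |ξ z.1 j|) with hZ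
  have hξj : ∀ j, Measurable fun b => ξ b j := fun j => (measurable_pi_apply j).comp hξm
  have hZm : Measurable Z := by
    refine Measurable.div (Measurable.mul (Measurable.sub (by fun_prop) ?_) ?_) ?_
    · exact measurable_dotProduct (hξm.comp measurable_fst) (by fun_prop)
    · exact measurable_polyWeight.comp measurable_snd
    · exact (Finset.measurable_sum _ fun j _ => ((hξj j).comp measurable_fst).norm).const_add 1
  have hZ1 : ∀ z, |Z z| ≤ 1 := by
    rintro ⟨b, z⟩
    have hw := polyWeight_pos z
    have habs : ∀ r : ℝ, r ^ 2 ≤ 1 + z.1 ⬝ᵥ z.1 + z.2 ^ 2 → |r| * polyWeight z ≤ 1 := by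
      intro r hr
      refine abs_mul_polyWeight_le ?_
      have := dotProduct_self_nonneg' z.1
      nlinarith [sq_nonneg (|r| - 1), sq_abs r, abs_nonneg r, sq_nonneg z.2]
    simp only [hZ]
    rw [abs_div, abs_of_pos (hden b), div_le_one (hden b), abs_mul, abs_of_pos hw]
    have h1 : |z.2 - ξ b ⬝ᵥ z.1| ≤ |z.2| + ∑ j, |ξ b j| * |z.1 j| := by
      refine (abs_sub _ _).trans (add_le_add_right ?_ _)
      refine (Finset.abs_sum_le_sum_abs _ _).trans (Finset.sum_le_sum fun j _ => ?_)
      rw [abs_mul]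
    refine (mul_le_mul_of_nonneg_right h1 hw.le).trans ?_
    rw [add_mul, Finset.sum_mul]
    refine add_le_add (habs _ (snd_sq_le z)) (Finset.sum_le_sum fun j _ => ?_)
    rw [mul_assoc]
    exact mul_le_of_le_one_right (abs_nonneg _) (habs _ (coord_sq_le z j))
  refine ⟨ξ, Z, hξm, hZm, hZ1, ?_, fun i A hAm => ?_⟩
  · intro z hz
    simp only [hZ] at hz
    have h1 := (div_eq_zero_iff.1 hz).resolve_right (hden z.1).ne'
    exact sub_eq_zero.1 ((mul_eq_zero.1 h1).resolve_right (polyWeight_pos _).ne')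
  · refine setIntegral_preimage_eq_zero hπ hUm (f := fun z => z.2.1 i * Z z)
      (Measurable.mul (by fun_prop) hZm) ?_ (Filter.Eventually.of_forall fun b => ?_) hAm
    · exact (hint i).mul_bdd (c := 1) (hZm.comp (hπ.prodMk hUm)).aestronglyMeasurable
        (Filter.Eventually.of_forall fun ω => hZ1 _)
    · have e : ∀ z : (ι → ℝ) × ℝ, z.1 i * Z (b, z) = (1 + ∑ j, |ξ b j|)⁻¹ *
          (z.2 * z.1 i * polyWeight z - ∑ j, ξ b j * (z.1 j * z.1 i * polyWeight z)) := by
        intro z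
        have : ∑ j, ξ b j * (z.1 j * z.1 i * polyWeight z) =
            (ξ b ⬝ᵥ z.1) * (z.1 i * polyWeight z) := by
          rw [dotProduct, Finset.sum_mul]
          exact Finset.sum_congr rfl fun j _ => by ring
        rw [this]
        simp only [hZ]
        rw [div_eq_inv_mul]
        ring
      have hcc : ∀ j, Integrable (fun z : (ι → ℝ) × ℝ => z.1 j * z.1 i * polyWeight z) (κ b) :=
        fun j => integrable_mul_mul_polyWeight (by fun_prop) (fun z => coord_sq_le z j)
          (by fun_prop) (fun z => coord_sq_le z i)
      change ∫ z : (ι → ℝ) × ℝ, z.1 i * Z (b, z) ∂(κ b) = 0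
      simp only [e]
      rw [integral_const_mul, integral_sub
        (integrable_mul_mul_polyWeight (by fun_prop) snd_sq_le (by fun_prop)
          fun z => coord_sq_le z i)
        (integrable_finsetSum _ fun j _ => (hcc j).const_mul _),
        integral_finsetSum _ fun j _ => (hcc j).const_mul _, hnormal]
      simp only [integral_const_mul]
      rw [sub_self, mul_zero]

end LeastSquares

section SubAlgebra

open scoped Matrix

variable {Ω ι : Type*} [Fintype ι] {m m' mΩ : MeasurableSpace Ω} {Q : Measure Ω} [IsFiniteMeasure Q]

lemma exists_martingale_density (hm : m ≤ m') (hm' : m' ≤ mΩ) {U : Ω → ι → ℝ}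
    (hU : Measurable[m'] U) (hint : ∀ i, Integrable (fun ω => U ω i) Q)
    (hNA : ∀ ξ : Ω → ι → ℝ, Measurable[m] ξ → (∀ᵐ ω ∂Q, 0 ≤ ξ ω ⬝ᵥ U ω) →
      ∀ᵐ ω ∂Q, ξ ω ⬝ᵥ U ω = 0) :
    ∃ Z : Ω → ℝ, Measurable[m'] Z ∧ (∀ ω, 0 < Z ω ∧ Z ω ≤ 1) ∧
      ∀ i (A : Set Ω), MeasurableSet[m] A → ∫ ω in A, U ω i * Z ω ∂Q = 0 := by
  obtain ⟨D, hD, hD1, hD0⟩ := @exists_oneperiod_martingale_density Ω Ω ι mΩ m _ Q _ id U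
    (measurable_id'' (hm.trans hm')) (hU.mono hm' le_rfl) hint hNA
  refine ⟨fun ω => D (ω, U ω), ?_, fun ω => hD1 _, hD0⟩
  have hid : @Measurable Ω Ω m' m id := measurable_id'' hm
  exact hD.comp (hid.prodMk hU)

lemma exists_residual (hm : m ≤ m') (hm' : m' ≤ mΩ) {x : Ω → ι → ℝ} {y : Ω → ℝ}
    (hx : Measurable[m'] x) (hy : Measurable[m'] y) (hint : ∀ i, Integrable (fun ω => x ω i) Q) :
    ∃ (ξ : Ω → ι → ℝ) (Z : Ω → ℝ), Measurable[m] ξ ∧ Measurable[m'] Z ∧ (∀ ω, |Z ω| ≤ 1) ∧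
      (∀ ω, Z ω = 0 → y ω = ξ ω ⬝ᵥ x ω) ∧
      ∀ i (A : Set Ω), MeasurableSet[m] A → ∫ ω in A, x ω i * Z ω ∂Q = 0 := by
  obtain ⟨ξ, Z, hξ, hZ, hZ1, hZ0, hZi⟩ := @exists_conditional_residual Ω Ω ι mΩ m _ Q _ id x y
    (measurable_id'' (hm.trans hm')) (hx.mono hm' le_rfl) (hy.mono hm' le_rfl) hint
  refine ⟨ξ, fun ω => Z (ω, (x ω, y ω)), hξ, ?_, fun ω => hZ1 _, fun ω => hZ0 (ω, (x ω, y ω)), hZi⟩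
  have hid : @Measurable Ω Ω m' m id := measurable_id'' hm
  exact hZ.comp (hid.prodMk (hx.prodMk hy))

lemma setIntegral_mul_eq_zero (hm : m ≤ mΩ) {f Z : Ω → ℝ} (hf : Integrable f Q)
    (h0 : ∀ A, MeasurableSet[m] A → ∫ ω in A, f ω ∂Q = 0) (hZ : Measurable[m] Z) {C : ℝ}
    (hC : ∀ ω, |Z ω| ≤ C) {A : Set Ω} (hA : MeasurableSet[m] A) :
    ∫ ω in A, Z ω * f ω ∂Q = 0 := by
  have hint : Integrable (Z * f) Q :=
    hf.bdd_mul (c := C) (hZ.mono hm le_rfl).aestronglyMeasurable (Filter.Eventually.of_forall hC)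
  have hf0 : (0 : Ω → ℝ) =ᵐ[Q] Q[f|m] := by
    refine ae_eq_condExp_of_forall_setIntegral_eq hm hf (fun _ _ _ => integrableOn_zero)
      (fun s hs _ => ?_) aestronglyMeasurable_zero
    rw [h0 s hs]
    simp
  have h1 := condExp_mul_of_stronglyMeasurable_left hZ.stronglyMeasurable hint hf
  have h2 : Q[Z * f|m] =ᵐ[Q] 0 := by
    filter_upwards [h1, hf0] with ω h1 h2
    rw [h1, Pi.mul_apply, ← h2]
    simp
  change ∫ ω in A, (Z * f) ω ∂Q = 0
  rw [← setIntegral_condExp hm hint hA, integral_congr_ae (ae_restrict_of_ae h2)]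
  simp

/-- Truncated portfolios with conditionally centred returns are conditionally centred. -/
lemma setIntegral_dotProduct_eq_zero (hm : m ≤ mΩ) {ξ U : Ω → ι → ℝ} (hξ : Measurable[m] ξ)
    (hU : ∀ i, Integrable (fun ω => U ω i) Q)
    (h0 : ∀ i A, MeasurableSet[m] A → ∫ ω in A, U ω i ∂Q = 0) {A : Set Ω}
    (hA : MeasurableSet[m] A) {C : ℝ} (hC : ∀ ω ∈ A, ∀ i, |ξ ω i| ≤ C) :
    IntegrableOn (fun ω => ξ ω ⬝ᵥ U ω) A Q ∧ ∫ ω in A, ξ ω ⬝ᵥ U ω ∂Q = 0 := by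
  have hCa : ∀ i ω, |A.indicator (fun ω => ξ ω i) ω| ≤ max C 0 := by
    intro i ω
    by_cases h : ω ∈ A
    · rw [Set.indicator_of_mem h]
      exact (hC ω h i).trans (le_max_left _ _)
    · rw [Set.indicator_of_notMem h, abs_zero]
      exact le_max_right _ _
  have hmi : ∀ i, Measurable[m] (A.indicator fun ω => ξ ω i) := fun i =>
    ((measurable_pi_apply i).comp hξ).indicator hA
  have hAm : MeasurableSet A := hm A hA
  have heq : ∀ ω ∈ A, ξ ω ⬝ᵥ U ω = ∑ i, A.indicator (fun ω => ξ ω i) ω * U ω i := by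
    intro ω h
    simp only [Set.indicator_of_mem h]
    rfl
  have hint : ∀ i, Integrable (fun ω => A.indicator (fun ω => ξ ω i) ω * U ω i) Q := fun i =>
    (hU i).bdd_mul (c := max C 0) ((hmi i).mono hm le_rfl).aestronglyMeasurable
      (Filter.Eventually.of_forall (hCa i))
  refine ⟨?_, ?_⟩
  · refine IntegrableOn.congr_fun ?_ (fun ω hω => (heq ω hω).symm) hAm
    exact (integrable_finsetSum _ fun i _ => hint i).integrableOn
  · rw [setIntegral_congr_fun hAm heq, integral_finsetSum _ fun i _ => (hint i).integrableOn]
    exact Finset.sum_eq_zero fun i _ => setIntegral_mul_eq_zero hm (hU i) (h0 i) (hmi i) (hCa i) hA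

lemma measurableSet_forall_abs_le {ξ : Ω → ι → ℝ} (hξ : Measurable[m] ξ) (C : ℝ) :
    MeasurableSet[m] {ω | ∀ i, |ξ ω i| ≤ C} := by
  have : {ω | ∀ i, |ξ ω i| ≤ C} = ⋂ i, {ω | |ξ ω i| ≤ C} := by ext; simp
  rw [this]
  exact MeasurableSet.iInter fun i =>
    measurableSet_le (((measurable_pi_apply i).comp hξ).norm) measurable_const

lemma exists_nat_forall_abs_le (v : ι → ℝ) : ∃ n : ℕ, ∀ i, |v i| ≤ n :=
  (exists_nat_ge ‖v‖).imp fun _ hn i => (norm_le_pi_norm v i).trans hn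

/-- No one-period arbitrage with conditionally centred returns. -/
lemma dotProduct_eq_zero_of_nonneg (hm : m ≤ mΩ) {ξ U : Ω → ι → ℝ} (hξ : Measurable[m] ξ)
    (hU : ∀ i, Integrable (fun ω => U ω i) Q)
    (h0 : ∀ i A, MeasurableSet[m] A → ∫ ω in A, U ω i ∂Q = 0)
    (hnn : ∀ᵐ ω ∂Q, 0 ≤ ξ ω ⬝ᵥ U ω) : ∀ᵐ ω ∂Q, ξ ω ⬝ᵥ U ω = 0 := by
  have key : ∀ n : ℕ, ∀ᵐ ω ∂Q, ω ∈ {ω | ∀ i, |ξ ω i| ≤ n} → ξ ω ⬝ᵥ U ω = 0 := by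
    intro n
    have hA := measurableSet_forall_abs_le hξ n
    obtain ⟨hi, hz⟩ := setIntegral_dotProduct_eq_zero hm hξ hU h0 hA (fun ω hω => hω)
    rw [← ae_restrict_iff' (hm _ hA)]
    exact (integral_eq_zero_iff_of_nonneg_ae (ae_restrict_of_ae hnn) hi).1 hz
  filter_upwards [ae_all_iff.2 key] with ω hω
  obtain ⟨n, hn⟩ := exists_nat_forall_abs_le (ξ ω)
  exact hω n hn

/-- In a conditional linear regression of a centred variable on centred variables, the intercept
vanishes. -/
lemma intercept_eq_zero (hm : m ≤ mΩ) {ξ U : Ω → ι → ℝ} {c y : Ω → ℝ} (hξ : Measurable[m] ξ)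
    (hc : Measurable[m] c) (hU : ∀ i, Integrable (fun ω => U ω i) Q) (hy : Integrable y Q)
    (h0 : ∀ i A, MeasurableSet[m] A → ∫ ω in A, U ω i ∂Q = 0)
    (hy0 : ∀ A, MeasurableSet[m] A → ∫ ω in A, y ω ∂Q = 0)
    (heq : ∀ᵐ ω ∂Q, y ω = c ω + ξ ω ⬝ᵥ U ω) : ∀ᵐ ω ∂Q, c ω = 0 := by
  have key : ∀ n : ℕ, ∀ᵐ ω ∂Q, ω ∈ {ω | ∀ i, |ξ ω i| ≤ n} → c ω = 0 := by
    intro n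
    have hA := measurableSet_forall_abs_le hξ n
    have hA' := hm _ hA
    have hc0 : ∀ᵐ ω ∂Q, c ω = y ω - ξ ω ⬝ᵥ U ω := by
      filter_upwards [heq] with ω hω
      linarith
    have hci : IntegrableOn c {ω | ∀ i, |ξ ω i| ≤ n} Q :=
      (hy.integrableOn.sub (setIntegral_dotProduct_eq_zero hm hξ hU h0 hA
        (fun ω hω => hω)).1).congr (ae_restrict_of_ae (by
          filter_upwards [hc0] with ω hω
          exact hω.symm))
    have hsub : ∀ B, MeasurableSet[m] B →
        ∫ ω in B ∩ {ω | ∀ i, |ξ ω i| ≤ n}, c ω ∂Q = 0 := by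
      intro B hB
      obtain ⟨hi, hz⟩ := setIntegral_dotProduct_eq_zero hm hξ hU h0 (hB.inter hA)
        (fun ω hω => hω.2)
      rw [integral_congr_ae (ae_restrict_of_ae hc0), integral_sub hy.integrableOn hi, hz,
        hy0 _ (hB.inter hA), sub_zero]
    rw [← ae_restrict_iff' hA']
    have h1 : c =ᵐ[Q.restrict {ω | ∀ i, |ξ ω i| ≤ n}] 0 := by
      refine ae_eq_of_forall_setIntegral_eq_of_sigmaFinite' hm
        (fun s _ _ => hci.integrableOn) (fun s _ _ => integrableOn_zero) (fun s hs _ => ?_)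
        hc.aestronglyMeasurable aestronglyMeasurable_zero
      rw [Measure.restrict_restrict (hm _ hs), hsub s hs]
      simp
    exact h1
  filter_upwards [ae_all_iff.2 key] with ω hω
  obtain ⟨n, hn⟩ := exists_nat_forall_abs_le (ξ ω)
  exact hω n hn

end SubAlgebra

/-- Change of measure by a strictly positive, integrable density. -/
lemma exists_probabilityMeasure_withDensity {Ω : Type*} [MeasurableSpace Ω] (Q : Measure Ω)
    [IsProbabilityMeasure Q] {D : Ω → ℝ} (hD : Measurable D) (hpos : ∀ ω, 0 < D ω)
    (hint : Integrable D Q) :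
    ∃ Q' : Measure Ω, IsProbabilityMeasure Q' ∧ Q' ≪ Q ∧ Q ≪ Q' ∧
      (∀ f : Ω → ℝ, Integrable f Q' ↔ Integrable (fun ω => f ω * D ω) Q) ∧
      ∀ (f : Ω → ℝ) (A : Set Ω), MeasurableSet A →
        ∫ ω in A, f ω ∂Q' = (∫ ω, D ω ∂Q)⁻¹ * ∫ ω in A, f ω * D ω ∂Q := by
  have hI : 0 < ∫ ω, D ω ∂Q := by
    rw [integral_pos_iff_support_of_nonneg (fun ω => (hpos ω).le) hint]
    have : Function.support D = Set.univ := by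
      ext ω
      simp [(hpos ω).ne']
    simp [this]
  set c := (∫ ω, D ω ∂Q)⁻¹ with hc
  have hc0 : 0 < c := inv_pos.2 hI
  have hcD : ∀ ω, 0 < c * D ω := fun ω => mul_pos hc0 (hpos ω)
  have hm : Measurable fun ω => ENNReal.ofReal (c * D ω) := (hD.const_mul c).ennreal_ofReal
  have hlt : ∀ ω, ENNReal.ofReal (c * D ω) < ∞ := fun ω => ENNReal.ofReal_lt_top
  refine ⟨Q.withDensity fun ω => ENNReal.ofReal (c * D ω), ⟨?_⟩,
    withDensity_absolutelyContinuous _ _, withDensity_absolutelyContinuous' hm.aemeasurable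
      (Filter.Eventually.of_forall fun ω => (ENNReal.ofReal_pos.2 (hcD ω)).ne'), fun f => ?_,
    fun f A hA => ?_⟩
  · rw [withDensity_apply _ MeasurableSet.univ, Measure.restrict_univ,
      ← ofReal_integral_eq_lintegral_ofReal (hint.const_mul c)
        (Filter.Eventually.of_forall fun ω => (hcD ω).le), integral_const_mul, hc,
      inv_mul_cancel₀ hI.ne', ENNReal.ofReal_one]
  · rw [integrable_withDensity_iff hm (Filter.Eventually.of_forall hlt)]
    have : (fun ω => f ω * (ENNReal.ofReal (c * D ω)).toReal) = fun ω => c * (f ω * D ω) := by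
      ext ω
      rw [ENNReal.toReal_ofReal (hcD ω).le]
      ring
    rw [this, integrable_const_mul_iff hc0.ne'.isUnit]
  · rw [setIntegral_withDensity_eq_setIntegral_toReal_smul hm
      (Filter.Eventually.of_forall fun ω => hlt ω) _ hA, ← integral_const_mul]
    refine integral_congr_ae (Filter.Eventually.of_forall fun ω => ?_)
    simp only [smul_eq_mul]
    rw [ENNReal.toReal_ofReal (hcD ω).le]
    ring

section MultiPeriod

open scoped Matrix

lemma measurable_sum_dotProduct {α κ ι : Type*} [Fintype ι] {m : MeasurableSpace α} (s : Finset κ)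
    {f g : κ → α → ι → ℝ} (hf : ∀ k ∈ s, Measurable[m] (f k)) (hg : ∀ k ∈ s, Measurable[m] (g k)) :
    Measurable[m] fun a => ∑ k ∈ s, f k a ⬝ᵥ g k a :=
  Finset.measurable_sum _ fun k hk => measurable_dotProduct (hf k hk) (hg k hk)

variable {Ω : Type*} {mΩ : MeasurableSpace Ω} {T d : ℕ} {P Q : Measure Ω}
  {ℱ : Filtration (Fin (T + 1)) mΩ} {X : Fin (T + 1) → Ω → Fin d → ℝ}

/-- The price increment over the period from `k` to `k + 1`. -/
def increment (X : Fin (T + 1) → Ω → Fin d → ℝ) (k : Fin T) (ω : Ω) : Fin d → ℝ :=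
  fun i => X k.succ ω i - X k.castSucc ω i

lemma measurable_increment (hX : Adapted ℱ X) (k : Fin T) :
    Measurable[ℱ k.succ] (increment X k) := by
  refine (@measurable_pi_iff _ _ _ (ℱ k.succ) _ _).2 fun i => ?_
  exact ((measurable_pi_apply i).comp (hX k.succ)).sub ((measurable_pi_apply i).comp
    ((hX k.castSucc).mono (ℱ.mono (Fin.castSucc_lt_succ).le) le_rfl))

/-- Absence of arbitrage in the period from `k` to `k + 1`. -/
def OnePeriodArbitrageFree (P : Measure Ω) (ℱ : Filtration (Fin (T + 1)) mΩ)
    (X : Fin (T + 1) → Ω → Fin d → ℝ) (k : Fin T) : Prop :=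
  ∀ ξ : Ω → Fin d → ℝ, Measurable[ℱ k.castSucc] ξ → (∀ᵐ ω ∂P, 0 ≤ ξ ω ⬝ᵥ increment X k ω) →
    ∀ᵐ ω ∂P, ξ ω ⬝ᵥ increment X k ω = 0

/-- The martingale property in the period from `k` to `k + 1`. -/
def FairPeriod (Q : Measure Ω) (ℱ : Filtration (Fin (T + 1)) mΩ)
    (X : Fin (T + 1) → Ω → Fin d → ℝ) (k : Fin T) : Prop :=
  ∀ i (A : Set Ω), MeasurableSet[ℱ k.castSucc] A → ∫ ω in A, increment X k ω i ∂Q = 0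

lemma gainsUntil_eq (ξ : Fin T → Ω → Fin d → ℝ) (s : Fin (T + 1)) (ω : Ω) :
    gainsUntil X ξ s ω = ∑ k : Fin T with k.succ ≤ s, ξ k ω ⬝ᵥ increment X k ω := rfl

lemma gainsUntil_last (ξ : Fin T → Ω → Fin d → ℝ) (ω : Ω) :
    gainsUntil X ξ (Fin.last T) ω = ∑ k : Fin T, ξ k ω ⬝ᵥ increment X k ω := by
  rw [gainsUntil_eq]
  congr 1
  ext k
  simp [Fin.le_last]

lemma gainsUntil_zero (ξ : Fin T → Ω → Fin d → ℝ) (ω : Ω) : gainsUntil X ξ 0 ω = 0 := by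
  rw [gainsUntil_eq]
  refine Finset.sum_eq_zero fun k hk => ?_
  simp at hk

lemma sum_filter_succ_le_succ (f : Fin T → ℝ) (k : Fin T) :
    ∑ j : Fin T with j.succ ≤ k.succ, f j = (∑ j : Fin T with j.succ ≤ k.castSucc, f j) + f k := by
  have : (Finset.univ.filter fun j : Fin T => j.succ ≤ k.succ) =
      insert k (Finset.univ.filter fun j : Fin T => j.succ ≤ k.castSucc) := by
    ext j
    simp only [Finset.mem_filter, Finset.mem_univ, true_and, Finset.mem_insert, Fin.le_def,
      Fin.val_succ, Fin.val_castSucc, Fin.ext_iff]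
    omega
  rw [this, Finset.sum_insert, add_comm]
  simp [Fin.le_def]

lemma gainsUntil_succ (ξ : Fin T → Ω → Fin d → ℝ) (k : Fin T) (ω : Ω) :
    gainsUntil X ξ k.succ ω =
      gainsUntil X ξ k.castSucc ω + ξ k ω ⬝ᵥ increment X k ω := by
  rw [gainsUntil_eq, gainsUntil_eq, sum_filter_succ_le_succ]

lemma gainsFrom_eq (t : Fin (T + 1)) (ξ : Fin T → Ω → Fin d → ℝ) (ω : Ω) :
    gainsFrom X t ξ ω = ∑ k : Fin T with t ≤ k.castSucc, ξ k ω ⬝ᵥ increment X k ω := by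
  rw [gainsFrom, gainsUntil_last, gainsUntil_eq,
    ← Finset.sum_filter_add_sum_filter_not Finset.univ (fun k : Fin T => k.succ ≤ t),
    add_sub_cancel_left]
  congr 1
  ext k
  simp only [Finset.mem_filter, Finset.mem_univ, true_and, Fin.le_def, Fin.val_succ,
    Fin.val_castSucc]
  omega

lemma sum_sub_eq (Y : Fin (T + 1) → ℝ) (s : Fin (T + 1)) :
    ∑ k : Fin T with k.succ ≤ s, (Y k.succ - Y k.castSucc) = Y s - Y 0 := by
  induction s using Fin.induction with
  | zero =>
    rw [sub_self]
    refine Finset.sum_eq_zero fun k hk => ?_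
    simp at hk
  | succ k ih =>
    rw [sum_filter_succ_le_succ, ih]
    ring

lemma sum_sub_from_eq (Y : Fin (T + 1) → ℝ) (t : Fin (T + 1)) :
    ∑ k : Fin T with t ≤ k.castSucc, (Y k.succ - Y k.castSucc) = Y (Fin.last T) - Y t := by
  have h1 := Finset.sum_filter_add_sum_filter_not Finset.univ (fun k : Fin T => k.succ ≤ t)
    (fun k => Y k.succ - Y k.castSucc)
  have h2 := sum_sub_eq Y (Fin.last T)
  have h3 : (Finset.univ.filter fun k : Fin T => k.succ ≤ Fin.last T) = Finset.univ := by
    ext k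
    simp [Fin.le_last]
  have h4 : (Finset.univ.filter fun k : Fin T => ¬ k.succ ≤ t) =
      Finset.univ.filter fun k : Fin T => t ≤ k.castSucc := by
    ext k
    simp only [Finset.mem_filter, Finset.mem_univ, true_and, Fin.le_def, Fin.val_succ,
      Fin.val_castSucc]
    omega
  rw [h3] at h2
  rw [h4, sum_sub_eq, h2] at h1
  linarith

lemma measurable_gainsUntil (hX : Adapted ℱ X) {ξ : Fin T → Ω → Fin d → ℝ}
    (hξ : IsPredictableStrategy ℱ ξ) (s : Fin (T + 1)) :
    Measurable[ℱ s] (gainsUntil X ξ s) := by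
  have : gainsUntil X ξ s = fun ω => ∑ k : Fin T with k.succ ≤ s, ξ k ω ⬝ᵥ increment X k ω := rfl
  rw [this]
  have hle : ∀ k ∈ Finset.univ.filter fun k : Fin T => k.succ ≤ s, k.succ ≤ s := fun k hk => by
    simpa using hk
  exact measurable_sum_dotProduct _
    (fun k hk => (hξ k).mono (ℱ.mono (Fin.castSucc_lt_succ.le.trans (hle k hk))) le_rfl)
    (fun k hk => (measurable_increment hX k).mono (ℱ.mono (hle k hk)) le_rfl)

lemma ArbitrageFree.onePeriod (h : ArbitrageFree P ℱ X) (k : Fin T) :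
    OnePeriodArbitrageFree P ℱ X k := by
  classical
  intro ξ hξ hnn
  set ζ : Fin T → Ω → Fin d → ℝ := fun j => if j = k then ξ else 0 with hζ
  have hgain : ∀ ω, gainsUntil X ζ (Fin.last T) ω = ξ ω ⬝ᵥ increment X k ω := by
    intro ω
    rw [gainsUntil_last, Finset.sum_eq_single k]
    · simp [hζ]
    · intro j _ hj
      simp [hζ, hj]
    · simp
  have := h ζ (fun j => by
    by_cases hj : j = k
    · subst hj; simpa [hζ] using hξ
    · simp only [hζ, if_neg hj]
      exact measurable_const) (by simpa only [hgain] using hnn)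
  simpa only [hgain] using this

lemma arbitrageFree_of_onePeriod (hX : Adapted ℱ X)
    (h : ∀ k, OnePeriodArbitrageFree P ℱ X k) : ArbitrageFree P ℱ X := by
  intro ξ hξ hnn
  have hall : ∀ s, ∀ᵐ ω ∂P, 0 ≤ gainsUntil X ξ s ω := by
    intro s
    induction s using Fin.reverseInduction with
    | last => exact hnn
    | cast k ih =>
      set A : Set Ω := {ω | gainsUntil X ξ k.castSucc ω < 0} with hA
      have hAm : MeasurableSet[ℱ k.castSucc] A :=
        measurableSet_lt (measurable_gainsUntil hX hξ _) measurable_const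
      have hval : ∀ ω ∈ A, A.indicator (ξ k) ω ⬝ᵥ increment X k ω =
          gainsUntil X ξ k.succ ω - gainsUntil X ξ k.castSucc ω := by
        intro ω hω
        rw [Set.indicator_of_mem hω, gainsUntil_succ]
        ring
      have h0 := h k (A.indicator (ξ k)) ((hξ k).indicator hAm) (by
        filter_upwards [ih] with ω hω
        by_cases hωA : ω ∈ A
        · rw [hval ω hωA]
          have : gainsUntil X ξ k.castSucc ω < 0 := hωA
          linarith
        · rw [Set.indicator_of_notMem hωA, zero_dotProduct])
      filter_upwards [ih, h0] with ω h1 h2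
      by_contra hneg
      push Not at hneg
      rw [hval ω hneg] at h2
      linarith
  have hzero : ∀ s, ∀ᵐ ω ∂P, gainsUntil X ξ s ω = 0 := by
    intro s
    induction s using Fin.induction with
    | zero => exact Filter.Eventually.of_forall (gainsUntil_zero ξ)
    | succ k ih =>
      have := h k (ξ k) (hξ k) (by
        filter_upwards [ih, hall k.succ] with ω h1 h2
        rw [gainsUntil_succ, h1] at h2
        linarith)
      filter_upwards [ih, this] with ω h1 h2
      rw [gainsUntil_succ, h1, h2, add_zero]
  exact hzero _

lemma OnePeriodArbitrageFree.congr {k : Fin T} (h : OnePeriodArbitrageFree P ℱ X k) (hQP : Q ≪ P)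
    (hPQ : P ≪ Q) : OnePeriodArbitrageFree Q ℱ X k :=
  fun ξ hξ hnn => hQP.ae_le (h ξ hξ (hPQ.ae_le hnn))

lemma FairPeriod.onePeriodArbitrageFree [IsFiniteMeasure Q] {k : Fin T} (h : FairPeriod Q ℱ X k)
    (hint : ∀ s i, Integrable (fun ω => X s ω i) Q) : OnePeriodArbitrageFree Q ℱ X k :=
  fun _ hξ hnn => dotProduct_eq_zero_of_nonneg (ℱ.le _) hξ (fun i => (hint _ i).sub (hint _ i))
    h hnn

lemma FairPeriod.of_martingale [IsFiniteMeasure Q]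
    (h : ∀ i, Martingale (fun s ω => X s ω i) ℱ Q) (k : Fin T) : FairPeriod Q ℱ X k := by
  intro i A hA
  have h1 := (h i).setIntegral_eq (Fin.castSucc_lt_succ (i := k)).le hA
  simp only [increment]
  rw [integral_sub ((h i).integrable _).integrableOn ((h i).integrable _).integrableOn, ← h1,
    sub_self]

lemma martingale_of_fairPeriod [IsFiniteMeasure Q] (hX : Adapted ℱ X)
    (hint : ∀ s i, Integrable (fun ω => X s ω i) Q) (h : ∀ k, FairPeriod Q ℱ X k) (i : Fin d) :
    Martingale (fun s ω => X s ω i) ℱ Q := by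
  have hmeas : ∀ s, Measurable[ℱ s] fun ω => X s ω i := fun s =>
    (measurable_pi_apply i).comp (hX s)
  refine ⟨fun s => (hmeas s).stronglyMeasurable, fun r s hrs => ?_⟩
  refine (ae_eq_condExp_of_forall_setIntegral_eq (ℱ.le r) (hint s i)
    (fun _ _ _ => (hint r i).integrableOn) (fun A hA _ => ?_)
    (hmeas r).aestronglyMeasurable).symm
  induction s using Fin.induction with
  | zero => rw [le_antisymm hrs (Fin.zero_le r)]
  | succ k ih =>
    rcases hrs.eq_or_lt with he | hlt
    · rw [he]
    · have hle : r ≤ k.castSucc := Fin.le_castSucc_iff.2 hlt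
      have h1 := h k i A (ℱ.mono hle A hA)
      simp only [increment] at h1
      rw [integral_sub (hint _ i).integrableOn (hint _ i).integrableOn, sub_eq_zero] at h1
      rw [h1]
      exact ih hle

/-- The easy half of the fundamental theorem of asset pricing. -/
theorem arbitrageFree_of_martingale [IsFiniteMeasure Q] (hX : Adapted ℱ X) (hQP : Q ≪ P)
    (hPQ : P ≪ Q) (h : ∀ i, Martingale (fun s ω => X s ω i) ℱ Q) : ArbitrageFree P ℱ X :=
  arbitrageFree_of_onePeriod hX fun k => ((FairPeriod.of_martingale h k).onePeriodArbitrageFree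
    fun s i => (h i).integrable s).congr hPQ hQP

/-- The Dalang–Morton–Willinger theorem, with a random variable to be made integrable. -/
theorem ArbitrageFree.exists_martingaleMeasure [IsProbabilityMeasure P] (hX : Adapted ℱ X)
    (h : ArbitrageFree P ℱ X) {H : Ω → ℝ} (hH : Measurable H) :
    ∃ Q : Measure Ω, IsProbabilityMeasure Q ∧ Q ≪ P ∧ P ≪ Q ∧ Integrable H Q ∧
      ∀ i, Martingale (fun s ω => X s ω i) ℱ Q := by
  have hXm : ∀ s i, Measurable fun ω => X s ω i := fun s i =>
    (measurable_pi_apply i).comp ((hX s).mono (ℱ.le s) le_rfl)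
  have key : ∀ n : ℕ, ∃ Q : Measure Ω, IsProbabilityMeasure Q ∧ Q ≪ P ∧ P ≪ Q ∧ Integrable H Q ∧
      (∀ s i, Integrable (fun ω => X s ω i) Q) ∧
      ∀ k : Fin T, T ≤ k + n → FairPeriod Q ℱ X k := by
    intro n
    induction n with
    | zero =>
      set V : Ω → ℝ := fun ω => |H ω| + ∑ s, ∑ i, |X s ω i| with hV
      have hVm : Measurable V := hH.norm.add (Finset.measurable_sum _ fun s _ =>
        Finset.measurable_sum _ fun i _ => (hXm s i).norm)
      have hS0 : ∀ ω, 0 ≤ ∑ s, ∑ i, |X s ω i| := fun ω =>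
        Finset.sum_nonneg fun s _ => Finset.sum_nonneg fun i _ => abs_nonneg _
      have hV0 : ∀ ω, 0 ≤ V ω := fun ω => add_nonneg (abs_nonneg _) (hS0 ω)
      have hDm : Measurable fun ω => Real.exp (-V ω) := hVm.neg.exp
      obtain ⟨Q, hQ, hQP, hPQ, hi, -⟩ := exists_probabilityMeasure_withDensity P
        (D := fun ω => Real.exp (-V ω)) hDm (fun ω => Real.exp_pos _)
        (Integrable.of_bound hDm.aestronglyMeasurable 1 (Filter.Eventually.of_forall fun ω => by
          rw [Real.norm_of_nonneg (Real.exp_pos _).le, Real.exp_le_one_iff]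
          linarith [hV0 ω]))
      have hbd : ∀ f : Ω → ℝ, Measurable f → (∀ ω, |f ω| ≤ V ω) → Integrable f Q := by
        intro f hf hfV
        rw [hi]
        refine Integrable.of_bound (hf.mul hDm).aestronglyMeasurable 1
          (Filter.Eventually.of_forall fun ω => ?_)
        rw [norm_mul, Real.norm_of_nonneg (Real.exp_pos _).le, Real.norm_eq_abs, Real.exp_neg,
          ← div_eq_mul_inv, div_le_one (Real.exp_pos _)]
        linarith [hfV ω, Real.add_one_le_exp (V ω)]
      refine ⟨Q, hQ, hQP, hPQ, hbd H hH fun ω => le_add_of_nonneg_right (hS0 ω),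
        fun s i => hbd _ (hXm s i) fun ω => ?_, fun k hk => absurd k.isLt (by omega)⟩
      have h1 : |X s ω i| ≤ ∑ i, |X s ω i| :=
        Finset.single_le_sum (f := fun i => |X s ω i|) (fun _ _ => abs_nonneg _)
          (Finset.mem_univ i)
      have h2 : ∑ i, |X s ω i| ≤ ∑ s, ∑ i, |X s ω i| :=
        Finset.single_le_sum (f := fun s => ∑ i, |X s ω i|)
          (fun _ _ => Finset.sum_nonneg fun _ _ => abs_nonneg _) (Finset.mem_univ s)
      exact (h1.trans h2).trans (le_add_of_nonneg_left (abs_nonneg _))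
    | succ n ih =>
      obtain ⟨Q, hQ, hQP, hPQ, hHi, hXi, hfair⟩ := ih
      by_cases hn : n < T
      swap
      · exact ⟨Q, hQ, hQP, hPQ, hHi, hXi, fun k _ => hfair k (by omega)⟩
      set k : Fin T := ⟨T - n - 1, by omega⟩ with hk
      have hUi : ∀ (j : Fin T) i, Integrable (fun ω => increment X j ω i) Q := fun j i =>
        (hXi _ i).sub (hXi _ i)
      obtain ⟨Z, hZ, hZ1, hZ0⟩ := exists_martingale_density
        (ℱ.mono (Fin.castSucc_lt_succ (i := k)).le) (ℱ.le k.succ) (measurable_increment hX k)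
        (hUi k) ((h.onePeriod k).congr hQP hPQ)
      have hZm : Measurable Z := hZ.mono (ℱ.le _) le_rfl
      have hZabs : ∀ ω, |Z ω| ≤ 1 := fun ω => by
        rw [abs_of_pos (hZ1 ω).1]; exact (hZ1 ω).2
      obtain ⟨Q', hQ', hQ'Q, hQQ', hi, hI⟩ := exists_probabilityMeasure_withDensity Q hZm
        (fun ω => (hZ1 ω).1) (Integrable.of_bound hZm.aestronglyMeasurable 1
          (Filter.Eventually.of_forall hZabs))
      have hbd : ∀ f : Ω → ℝ, Integrable f Q → Integrable f Q' := fun f hf =>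
        (hi f).2 (hf.mul_bdd (c := 1) hZm.aestronglyMeasurable (Filter.Eventually.of_forall hZabs))
      refine ⟨Q', hQ', hQ'Q.trans hQP, hPQ.trans hQQ', hbd _ hHi, fun s i => hbd _ (hXi s i),
        fun j hj i A hA => ?_⟩
      rw [hI _ _ (ℱ.le _ A hA)]
      by_cases hjk : j = k
      · subst hjk
        rw [hZ0 i A hA, mul_zero]
      · have hjn : T ≤ j + n := by
          have : (j : ℕ) ≠ T - n - 1 := fun he => hjk (Fin.ext he)
          omega
        have hlt : k.succ ≤ j.castSucc := by
          rw [Fin.le_def, Fin.val_succ, Fin.val_castSucc, hk]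
          simp only
          omega
        have := setIntegral_mul_eq_zero (ℱ.le _) (hUi j i) (hfair j hjn i)
          (hZ.mono (ℱ.mono hlt) le_rfl) hZabs hA
        simp only [mul_comm (Z _)] at this
        rw [this, mul_zero]
  obtain ⟨Q, hQ, hQP, hPQ, hHi, hXi, hfair⟩ := key T
  exact ⟨Q, hQ, hQP, hPQ, hHi, martingale_of_fairPeriod hX hXi fun k => hfair k (by omega)⟩

end MultiPeriod

section Pricing

open scoped Matrix

variable {Ω : Type*} {mΩ : MeasurableSpace Ω} {T d : ℕ} {P Q : Measure Ω}
  {ℱ : Filtration (Fin (T + 1)) mΩ} {X : Fin (T + 1) → Ω → Fin d → ℝ} {t : Fin (T + 1)}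

lemma extendMarket_castSucc (Y : Fin (T + 1) → Ω → ℝ) (s : Fin (T + 1)) (ω : Ω) (i : Fin d) :
    extendMarket X Y s ω i.castSucc = X s ω i := by
  simp [extendMarket]

lemma extendMarket_last (Y : Fin (T + 1) → Ω → ℝ) (s : Fin (T + 1)) (ω : Ω) :
    extendMarket X Y s ω (Fin.last d) = Y s ω := by
  simp [extendMarket]

lemma adapted_extendMarket (hX : Adapted ℱ X) {Y : Fin (T + 1) → Ω → ℝ} (hY : Adapted ℱ Y) :
    Adapted ℱ (extendMarket X Y) := by
  intro s
  refine (@measurable_pi_iff _ _ _ (ℱ s) _ _).2 fun i => ?_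
  induction i using Fin.lastCases with
  | last => simpa only [extendMarket_last] using hY s
  | cast i =>
    simp only [extendMarket_castSucc]
    exact (measurable_pi_apply i).comp (hX s)

lemma snoc_dotProduct_increment (Y : Fin (T + 1) → Ω → ℝ) (k : Fin T) (ω : Ω) (v : Fin d → ℝ)
    (a : ℝ) : Fin.snoc (α := fun _ => ℝ) v a ⬝ᵥ increment (extendMarket X Y) k ω =
      v ⬝ᵥ increment X k ω + a * (Y k.succ ω - Y k.castSucc ω) := by
  simp only [dotProduct, Fin.sum_univ_castSucc, increment, extendMarket_castSucc,
    extendMarket_last, Fin.snoc_castSucc, Fin.snoc_last]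

/-- Conditional expectations under equivalent martingale measures are arbitrage-free prices. -/
lemma isArbitrageFreePrice_condExp [IsProbabilityMeasure Q] (hX : Adapted ℱ X) (hQP : Q ≪ P)
    (hPQ : P ≪ Q) (h : ∀ i, Martingale (fun s ω => X s ω i) ℱ Q) {H : Ω → ℝ}
    (hH : Measurable[ℱ (Fin.last T)] H) (hint : Integrable H Q) (t : Fin (T + 1)) :
    IsArbitrageFreePrice P ℱ X t H (Q[H|ℱ t]) := by
  have hYa : Adapted ℱ fun s => Q[H|ℱ s] := fun s => stronglyMeasurable_condExp.measurable
  refine ⟨stronglyMeasurable_condExp.measurable, fun s => Q[H|ℱ s], hYa, Filter.EventuallyEq.rfl,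
    ?_, ?_⟩
  · change Q[H|ℱ (Fin.last T)] =ᵐ[P] H
    rw [condExp_of_stronglyMeasurable (ℱ.le _) hH.stronglyMeasurable hint]
  · refine arbitrageFree_of_martingale (Q := Q) (adapted_extendMarket hX hYa) hQP hPQ fun i => ?_
    induction i using Fin.lastCases with
    | last =>
      simp only [extendMarket_last]
      exact martingale_condExp H ℱ Q
    | cast i =>
      simp only [extendMarket_castSucc]
      exact h i

lemma ae_nonpos_of_price {H Ht p : Ω → ℝ} {ξ : Fin T → Ω → Fin d → ℝ} (ε : ℝ)
    (hξ : IsPredictableStrategy ℱ ξ) (hHt : Measurable[ℱ t] Ht)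
    (hH : ∀ᵐ ω ∂P, H ω = Ht ω + gainsFrom X t ξ ω) (hp : IsArbitrageFreePrice P ℱ X t H p) :
    ∀ᵐ ω ∂P, ε * (p ω - Ht ω) ≤ 0 := by
  classical
  obtain ⟨hpm, Y, hYa, hYt, hYT, hNA⟩ := hp
  set A : Set Ω := {ω | 0 < ε * (p ω - Ht ω)} with hA
  have hAm : MeasurableSet[ℱ t] A :=
    measurableSet_lt measurable_const ((hpm.sub hHt).const_mul ε)
  set ζ : Fin T → Ω → Fin (d + 1) → ℝ := fun k => if t ≤ k.castSucc then
    A.indicator fun ω => Fin.snoc (α := fun _ => ℝ) (ε • ξ k ω) (-ε) else 0 with hζ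
  have hζm : IsPredictableStrategy ℱ ζ := by
    intro k
    by_cases hk : t ≤ k.castSucc
    · simp only [hζ, if_pos hk]
      refine Measurable.indicator ?_ (ℱ.mono hk A hAm)
      refine (@measurable_pi_iff _ _ _ (ℱ k.castSucc) _ _).2 fun i => ?_
      induction i using Fin.lastCases with
      | last => simpa only [Fin.snoc_last] using measurable_const
      | cast i =>
        simp only [Fin.snoc_castSucc, Pi.smul_apply, smul_eq_mul]
        exact ((measurable_pi_apply i).comp (hξ k)).const_mul ε
    · simp only [hζ, if_neg hk]
      exact measurable_const
  have hgain : ∀ ω, gainsUntil (extendMarket X Y) ζ (Fin.last T) ω =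
      A.indicator (fun ω => ε * (gainsFrom X t ξ ω - (Y (Fin.last T) ω - Y t ω))) ω := by
    intro ω
    rw [gainsUntil_last]
    by_cases hω : ω ∈ A
    · rw [Set.indicator_of_mem hω, gainsFrom_eq, ← sum_sub_from_eq (fun s => Y s ω) t,
        ← Finset.sum_sub_distrib, Finset.mul_sum, Finset.sum_filter]
      refine Finset.sum_congr rfl fun k _ => ?_
      by_cases hk : t ≤ k.castSucc
      · simp only [hζ, if_pos hk, Set.indicator_of_mem hω]
        rw [snoc_dotProduct_increment, smul_dotProduct, smul_eq_mul]
        ring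
      · simp only [hζ, if_neg hk, Pi.zero_apply, zero_dotProduct]
    · rw [Set.indicator_of_notMem hω]
      refine Finset.sum_eq_zero fun k _ => ?_
      by_cases hk : t ≤ k.castSucc
      · simp only [hζ, if_pos hk, Set.indicator_of_notMem hω, zero_dotProduct]
      · simp only [hζ, if_neg hk, Pi.zero_apply, zero_dotProduct]
  have hval : ∀ᵐ ω ∂P, gainsUntil (extendMarket X Y) ζ (Fin.last T) ω =
      A.indicator (fun ω => ε * (p ω - Ht ω)) ω := by
    filter_upwards [hH, hYt, hYT] with ω h1 h2 h3
    rw [hgain]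
    by_cases hω : ω ∈ A
    · rw [Set.indicator_of_mem hω, Set.indicator_of_mem hω, h2, h3, h1]
      ring
    · rw [Set.indicator_of_notMem hω, Set.indicator_of_notMem hω]
  have h0 := hNA ζ hζm (by
    filter_upwards [hval] with ω hω
    rw [hω]
    exact Set.indicator_nonneg (fun ω (hω : 0 < _) => hω.le) ω)
  filter_upwards [hval, h0] with ω h1 h2
  by_contra hpos
  push Not at hpos
  rw [h2, Set.indicator_of_mem (show ω ∈ A from hpos)] at h1
  linarith

/-- Arbitrage-free prices agree with the replication cost. -/
lemma Attainable.price_ae_eq {H Ht p : Ω → ℝ} {ξ : Fin T → Ω → Fin d → ℝ}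
    (hξ : IsPredictableStrategy ℱ ξ) (hHt : Measurable[ℱ t] Ht)
    (hH : ∀ᵐ ω ∂P, H ω = Ht ω + gainsFrom X t ξ ω) (hp : IsArbitrageFreePrice P ℱ X t H p) :
    p =ᵐ[P] Ht := by
  filter_upwards [ae_nonpos_of_price 1 hξ hHt hH hp, ae_nonpos_of_price (-1) hξ hHt hH hp]
    with ω h1 h2
  linarith

lemma CompleteAt.hasUniquePrice [IsProbabilityMeasure P] (hX : Adapted ℱ X)
    (hNA : ArbitrageFree P ℱ X) (h : CompleteAt P ℱ X t) {H : Ω → ℝ} (hH : IsClaim P ℱ H) :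
    HasUniquePrice P ℱ X t H := by
  obtain ⟨ξ, Ht, hξ, hHt, heq⟩ := h H hH
  obtain ⟨Q, hQ, hQP, hPQ, hHi, hM⟩ :=
    hNA.exists_martingaleMeasure hX (hH.1.mono (ℱ.le _) le_rfl)
  have hprice := isArbitrageFreePrice_condExp hX hQP hPQ hM hH.1 hHi t
  exact ⟨_, hprice, fun p hp => (Attainable.price_ae_eq hξ hHt heq hp).trans
    (Attainable.price_ae_eq hξ hHt heq hprice).symm⟩

end Pricing

section PastingProperties

variable {Ω : Type*} {m mΩ : MeasurableSpace Ω}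

lemma pasting_apply_of_measurableSet (hm : m ≤ mΩ) {R Q : ProbabilityMeasure Ω}
    (h : (R : Measure Ω) ≪ (Q : Measure Ω)) {A : Set Ω} (hA : MeasurableSet[m] A) :
    (pasting m hm R Q h : Measure Ω) A = (R : Measure Ω) A := by
  change pastingMeasure m R Q h A = _
  have hind : Measurable[m] (A.indicator fun _ => (1 : ℝ≥0∞)) := measurable_const.indicator hA
  rw [pastingMeasure_apply m _ _ h (hm A hA), condLExp_eq_self hm _ hind,
    lintegral_indicator_const (hm A hA), one_mul]

lemma pasting_congr_left (hm : m ≤ mΩ) {R R' Q : ProbabilityMeasure Ω}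
    (h : (R : Measure Ω) ≪ (Q : Measure Ω)) (h' : (R' : Measure Ω) ≪ (Q : Measure Ω))
    (hRR' : ∀ A, MeasurableSet[m] A → (R : Measure Ω) A = (R' : Measure Ω) A) :
    pasting m hm R Q h = pasting m hm R' Q h' := by
  refine Subtype.ext (Measure.ext fun A hA => ?_)
  change pastingMeasure m R Q h A = pastingMeasure m R' Q h' A
  have htrim : (R : Measure Ω).trim hm = (R' : Measure Ω).trim hm :=
    @Measure.ext _ m _ _ fun B hB => by
      rw [trim_measurableSet_eq hm hB, trim_measurableSet_eq hm hB, hRR' B hB]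
  rw [pastingMeasure_apply m _ _ h hA, pastingMeasure_apply m _ _ h' hA,
    ← lintegral_trim hm (measurable_condLExp m _ _), htrim,
    lintegral_trim hm (measurable_condLExp m _ _)]

lemma pasting_eq_left (hm : m ≤ mΩ) {R Q : ProbabilityMeasure Ω}
    (h : (R : Measure Ω) ≪ (Q : Measure Ω))
    (hcond : ∀ A : Set Ω, MeasurableSet A →
      (Q : Measure Ω)⟦A|m⟧ =ᵐ[(R : Measure Ω)] (R : Measure Ω)⟦A|m⟧) :
    pasting m hm R Q h = R := by
  refine Subtype.ext (Measure.ext fun A hA => ?_)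
  refine (measureReal_eq_measureReal_iff (measure_ne_top (pasting m hm R Q h : Measure Ω) A)
    (measure_ne_top (R : Measure Ω) A)).1 ?_
  change (pastingMeasure m R Q h).real A = _
  rw [pastingMeasure_real m _ _ h hA, integral_congr_ae (hcond A hA), integral_condExp hm,
    integral_indicator_const _ hA, smul_eq_mul, mul_one]

lemma eq_of_eq_pastingSet (hm : m ≤ mΩ) {M : Set (ProbabilityMeasure Ω)}
    {Qstar : ProbabilityMeasure Ω} (hM : M = pastingSet m hm M Qstar) {Q Q' : ProbabilityMeasure Ω}
    (hQ : Q ∈ M) (hQ' : Q' ∈ M)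
    (h : ∀ A, MeasurableSet[m] A → (Q' : Measure Ω) A = (Q : Measure Ω) A) : Q' = Q := by
  rw [hM] at hQ hQ'
  obtain ⟨R, -, hac, rfl⟩ := hQ
  obtain ⟨R', -, hac', rfl⟩ := hQ'
  refine pasting_congr_left hm hac' hac fun A hA => ?_
  have := h A hA
  rwa [pasting_apply_of_measurableSet hm _ hA, pasting_apply_of_measurableSet hm _ hA] at this

end PastingProperties

section Main

open scoped Matrix

variable {Ω : Type*} {mΩ : MeasurableSpace Ω} {T d : ℕ} {P : Measure Ω}
  {ℱ : Filtration (Fin (T + 1)) mΩ} {X : Fin (T + 1) → Ω → Fin d → ℝ} {t : Fin (T + 1)}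

lemma pasting_eq_of_hasUniquePrice (hℱT : ℱ (Fin.last T) = mΩ) (hX : Adapted ℱ X)
    (h : ∀ H : Ω → ℝ, IsClaim P ℱ H → HasUniquePrice P ℱ X t H) {Q Qstar : ProbabilityMeasure Ω}
    (hQ : Q ∈ equivMartingaleMeasures P ℱ X) (hQs : Qstar ∈ equivMartingaleMeasures P ℱ X)
    (hac : (Q : Measure Ω) ≪ (Qstar : Measure Ω)) :
    pasting (ℱ t) (ℱ.le t) Q Qstar hac = Q := by
  refine pasting_eq_left _ _ fun A hA => ?_
  have hm : Measurable[ℱ (Fin.last T)] (A.indicator fun _ => (1 : ℝ)) := by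
    rw [hℱT]
    exact measurable_const.indicator hA
  have hint : ∀ R : ProbabilityMeasure Ω, Integrable (A.indicator fun _ => (1 : ℝ))
      (R : Measure Ω) := fun R => (integrable_const _).indicator hA
  obtain ⟨p, -, hp⟩ := h (A.indicator fun _ => 1)
    ⟨hm, Filter.Eventually.of_forall fun ω => Set.indicator_nonneg (fun _ _ => zero_le_one) ω⟩
  have h1 := hp _ (isArbitrageFreePrice_condExp hX hQ.1 hQ.2.1 hQ.2.2 hm (hint Q) t)
  have h2 := hp _ (isArbitrageFreePrice_condExp hX hQs.1 hQs.2.1 hQs.2.2 hm (hint Qstar) t)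
  exact hQ.1.ae_le (h2.trans h1.symm)

lemma eq_pastingSet_of_hasUniquePrice (hℱT : ℱ (Fin.last T) = mΩ) (hX : Adapted ℱ X)
    (h : ∀ H : Ω → ℝ, IsClaim P ℱ H → HasUniquePrice P ℱ X t H) {Qstar : ProbabilityMeasure Ω}
    (hQs : Qstar ∈ equivMartingaleMeasures P ℱ X) :
    equivMartingaleMeasures P ℱ X =
      pastingSet (ℱ t) (ℱ.le t) (equivMartingaleMeasures P ℱ X) Qstar := by
  ext R
  constructor
  · intro hR
    exact ⟨R, hR, hR.1.trans hQs.2.1, (pasting_eq_of_hasUniquePrice hℱT hX h hR hQs _).symm⟩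
  · rintro ⟨Q, hQ, hac, rfl⟩
    rwa [pasting_eq_of_hasUniquePrice hℱT hX h hQ hQs]

/-- If an equivalent martingale measure is determined by its restriction to the information at the
beginning of a period, then every martingale increment over that period can be replicated. -/
lemma exists_replication (hX : Adapted ℱ X) {Q : ProbabilityMeasure Ω}
    (hQ : Q ∈ equivMartingaleMeasures P ℱ X) {k : Fin T}
    (hdet : ∀ Q' ∈ equivMartingaleMeasures P ℱ X,
      (∀ A, MeasurableSet[ℱ k.castSucc] A → (Q' : Measure Ω) A = (Q : Measure Ω) A) → Q' = Q)
    {y : Ω → ℝ} (hy : Measurable[ℱ k.succ] y) (hyi : Integrable y (Q : Measure Ω))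
    (hy0 : ∀ A, MeasurableSet[ℱ k.castSucc] A → ∫ ω in A, y ω ∂(Q : Measure Ω) = 0) :
    ∃ ξ : Ω → Fin d → ℝ, Measurable[ℱ k.castSucc] ξ ∧
      ∀ᵐ ω ∂(Q : Measure Ω), y ω = ξ ω ⬝ᵥ increment X k ω := by
  obtain ⟨hQP, hPQ, hM⟩ := hQ
  have hXi : ∀ s i, Integrable (fun ω => X s ω i) (Q : Measure Ω) := fun s i => (hM i).integrable s
  have hUi : ∀ (j : Fin T) i, Integrable (fun ω => increment X j ω i) (Q : Measure Ω) :=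
    fun j i => (hXi _ i).sub (hXi _ i)
  have hfair := FairPeriod.of_martingale hM
  set x : Ω → Option (Fin d) → ℝ := fun ω o => o.elim 1 (increment X k ω) with hx
  have hxm : Measurable[ℱ k.succ] x := by
    refine (@measurable_pi_iff _ _ _ (ℱ k.succ) _ _).2 fun o => ?_
    cases o with
    | none => exact measurable_const
    | some i => exact (measurable_pi_apply i).comp (measurable_increment hX k)
  obtain ⟨ξ, Z, hξ, hZ, hZ1, hZ0, hZx⟩ := exists_residual
    (ℱ.mono (Fin.castSucc_lt_succ (i := k)).le) (ℱ.le k.succ) hxm hy (Q := (Q : Measure Ω))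
    (fun o => by
      cases o with
      | none => exact integrable_const _
      | some i => exact hUi k i)
  have hZm : Measurable Z := hZ.mono (ℱ.le _) le_rfl
  have hZi : Integrable Z (Q : Measure Ω) :=
    Integrable.of_bound hZm.aestronglyMeasurable 1 (Filter.Eventually.of_forall hZ1)
  have hZA : ∀ A, MeasurableSet[ℱ k.castSucc] A → ∫ ω in A, Z ω ∂(Q : Measure Ω) = 0 :=
      fun A hA => by
    simpa [hx] using hZx none A hA
  have hZU : ∀ i A, MeasurableSet[ℱ k.castSucc] A →
      ∫ ω in A, increment X k ω i * Z ω ∂(Q : Measure Ω) = 0 := fun i A hA => hZx (some i) A hA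
  set D : Ω → ℝ := fun ω => 1 + Z ω / 2 with hD
  have hDm : Measurable[ℱ k.succ] D := (hZ.div_const 2).const_add 1
  have hDpos : ∀ ω, 0 < D ω := fun ω => by
    have := abs_le.1 (hZ1 ω)
    simp only [hD]
    linarith
  have hDabs : ∀ ω, |D ω| ≤ 2 := fun ω => by
    have := abs_le.1 (hZ1 ω)
    rw [abs_of_pos (hDpos ω)]
    simp only [hD]
    linarith
  have hDm' : Measurable D := hDm.mono (ℱ.le _) le_rfl
  have hDi : Integrable D (Q : Measure Ω) := (integrable_const 1).add (hZi.div_const 2)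
  have hDA : ∀ A, MeasurableSet[ℱ k.castSucc] A →
      ∫ ω in A, D ω ∂(Q : Measure Ω) = (Q : Measure Ω).real A := fun A hA => by
    simp only [hD]
    rw [integral_add (integrable_const _) (hZi.div_const 2).integrableOn, integral_div, hZA A hA]
    simp
  obtain ⟨Q', hQ', hQ'Q, hQQ', hi, hI⟩ :=
    exists_probabilityMeasure_withDensity (Q : Measure Ω) hDm' hDpos hDi
  have hD1 : ∫ ω, D ω ∂(Q : Measure Ω) = 1 := by
    have := hDA Set.univ MeasurableSet.univ
    rwa [setIntegral_univ, probReal_univ] at this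
  simp only [hD1, inv_one, one_mul] at hI
  have hbd : ∀ f : Ω → ℝ, Integrable f (Q : Measure Ω) → Integrable f Q' := fun f hf =>
    (hi f).2 (hf.mul_bdd (c := 2) hDm'.aestronglyMeasurable (Filter.Eventually.of_forall hDabs))
  have hfair' : ∀ j, FairPeriod Q' ℱ X j := by
    intro j i A hA
    rw [hI _ _ (ℱ.le _ A hA)]
    rcases lt_trichotomy j k with hjk | hjk | hjk
    · have hle : j.succ ≤ k.castSucc := by
        rw [Fin.lt_def] at hjk
        rw [Fin.le_def, Fin.val_succ, Fin.val_castSucc]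
        omega
      have hAk : MeasurableSet[ℱ k.castSucc] A := ℱ.mono (Fin.castSucc_lt_succ.le.trans hle) A hA
      have hUm : Measurable[ℱ k.castSucc] fun ω => increment X j ω i :=
        ((measurable_pi_apply i).comp (measurable_increment hX j)).mono (ℱ.mono hle) le_rfl
      have hint : Integrable (fun ω => increment X j ω i * Z ω) (Q : Measure Ω) :=
        (hUi j i).mul_bdd (c := 1) hZm.aestronglyMeasurable (Filter.Eventually.of_forall hZ1)
      have hz : ∫ ω in A, increment X j ω i * Z ω ∂(Q : Measure Ω) = 0 := by
        have hc := condExp_mul_of_stronglyMeasurable_left hUm.stronglyMeasurable hint hZi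
        have hc0 : (0 : Ω → ℝ) =ᵐ[(Q : Measure Ω)] (Q : Measure Ω)[Z|ℱ k.castSucc] :=
          ae_eq_condExp_of_forall_setIntegral_eq (ℱ.le _) hZi (fun _ _ _ => integrableOn_zero)
            (fun s hs _ => by rw [hZA s hs]; simp) aestronglyMeasurable_zero
        change ∫ ω in A, ((fun ω => increment X j ω i) * Z) ω ∂(Q : Measure Ω) = 0
        rw [← setIntegral_condExp (ℱ.le k.castSucc)
          (f := (fun ω => increment X j ω i) * Z) hint hAk,
          integral_congr_ae (g := fun _ => (0 : ℝ))]
        · simp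
        · refine ae_restrict_of_ae ?_
          filter_upwards [hc, hc0] with ω h1 h2
          rw [h1, Pi.mul_apply, ← h2]
          simp
      have e : ∀ ω, increment X j ω i * D ω =
          increment X j ω i + increment X j ω i * Z ω / 2 := fun ω => by
        simp only [hD]; ring
      simp only [e]
      rw [integral_add (hUi j i).integrableOn (hint.div_const 2).integrableOn, integral_div, hz,
        hfair j i A hA]
      simp
    · subst hjk
      have hint : Integrable (fun ω => increment X j ω i * Z ω) (Q : Measure Ω) :=
        (hUi j i).mul_bdd (c := 1) hZm.aestronglyMeasurable (Filter.Eventually.of_forall hZ1)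
      have e : ∀ ω, increment X j ω i * D ω =
          increment X j ω i + increment X j ω i * Z ω / 2 := fun ω => by
        simp only [hD]; ring
      simp only [e]
      rw [integral_add (hUi j i).integrableOn (hint.div_const 2).integrableOn, integral_div,
        hZU i A hA, hfair j i A hA]
      simp
    · have hle : k.succ ≤ j.castSucc := by
        rw [Fin.lt_def] at hjk
        rw [Fin.le_def, Fin.val_succ, Fin.val_castSucc]
        omega
      have := setIntegral_mul_eq_zero (ℱ.le _) (hUi j i) (hfair j i)
        (hDm.mono (ℱ.mono hle) le_rfl) hDabs hA
      simpa only [mul_comm (D _)] using this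
  have hmem : (⟨Q', hQ'⟩ : ProbabilityMeasure Ω) ∈ equivMartingaleMeasures P ℱ X :=
    ⟨hQ'Q.trans hQP, hPQ.trans hQQ',
      martingale_of_fairPeriod (Q := Q') hX (fun s i => hbd _ (hXi s i)) hfair'⟩
  have hQ'A : ∀ A, MeasurableSet A → Q'.real A = ∫ ω in A, D ω ∂(Q : Measure Ω) := fun A hA => by
    simpa using hI (fun _ => 1) A hA
  have heq := hdet _ hmem fun A hA => by
    refine (measureReal_eq_measureReal_iff (measure_ne_top Q' A) (measure_ne_top _ _)).1 ?_
    exact (hQ'A A (ℱ.le _ A hA)).trans (hDA A hA)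
  have heq' : Q' = (Q : Measure Ω) := congrArg Subtype.val heq
  have hDone : D =ᵐ[(Q : Measure Ω)] fun _ => 1 := by
    refine Integrable.ae_eq_of_forall_setIntegral_eq D (fun _ => 1) hDi (integrable_const _)
      fun A hA _ => ?_
    rw [← hQ'A A hA, heq']
    simp
  have hrep : ∀ᵐ ω ∂(Q : Measure Ω), y ω =
      ξ ω none + (fun i => ξ ω (some i)) ⬝ᵥ increment X k ω := by
    filter_upwards [hDone] with ω hω
    rw [hZ0 ω (by simp only [hD] at hω; linarith), dotProduct, Fintype.sum_option]
    simp [hx, dotProduct]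
  have hξs : Measurable[ℱ k.castSucc] fun ω (i : Fin d) => ξ ω (some i) :=
    (@measurable_pi_iff _ _ _ (ℱ k.castSucc) _ _).2 fun i => (measurable_pi_apply (some i)).comp hξ
  refine ⟨fun ω i => ξ ω (some i), hξs, ?_⟩
  filter_upwards [hrep, intercept_eq_zero (ℱ.le _) hξs ((measurable_pi_apply none).comp hξ)
    (hUi k) hyi (hfair k) hy0 hrep] with ω h1 h2
  rw [h1]
  simp only [Function.comp_apply] at h2
  rw [h2, zero_add]

lemma completeAt_of_eq_pastingSet [IsProbabilityMeasure P] (hX : Adapted ℱ X)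
    (hNA : ArbitrageFree P ℱ X) {Qstar : ProbabilityMeasure Ω}
    (hM : equivMartingaleMeasures P ℱ X =
      pastingSet (ℱ t) (ℱ.le t) (equivMartingaleMeasures P ℱ X) Qstar) :
    CompleteAt P ℱ X t := by
  classical
  intro H hH
  obtain ⟨Q, hQ, hQP, hPQ, hHi, hMart⟩ :=
    hNA.exists_martingaleMeasure hX (hH.1.mono (ℱ.le _) le_rfl)
  have hmem : (⟨Q, hQ⟩ : ProbabilityMeasure Ω) ∈ equivMartingaleMeasures P ℱ X :=
    ⟨hQP, hPQ, hMart⟩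
  have hY := martingale_condExp H ℱ Q
  have hrep : ∀ k : Fin T, ∃ ξ : Ω → Fin d → ℝ, Measurable[ℱ k.castSucc] ξ ∧
      (t ≤ k.castSucc → ∀ᵐ ω ∂P, (Q[H|ℱ k.succ]) ω - (Q[H|ℱ k.castSucc]) ω =
        ξ ω ⬝ᵥ increment X k ω) := by
    intro k
    by_cases hk : t ≤ k.castSucc
    · have hle := (Fin.castSucc_lt_succ (i := k)).le
      obtain ⟨ξ, hξ, h⟩ := exists_replication hX hmem (k := k)
        (y := fun ω => (Q[H|ℱ k.succ]) ω - (Q[H|ℱ k.castSucc]) ω)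
        (fun Q' hQ' hagree => eq_of_eq_pastingSet (ℱ.le t) hM hmem hQ'
          fun A hA => hagree A (ℱ.mono hk A hA))
        (stronglyMeasurable_condExp.measurable.sub
          (stronglyMeasurable_condExp.measurable.mono (ℱ.mono hle) le_rfl))
        (integrable_condExp.sub integrable_condExp)
        (fun A hA => by
          change ∫ ω in A, ((Q[H|ℱ k.succ]) ω - (Q[H|ℱ k.castSucc]) ω) ∂Q = 0
          rw [integral_sub integrable_condExp.integrableOn integrable_condExp.integrableOn,
            hY.setIntegral_eq hle hA, sub_self])
      exact ⟨ξ, hξ, fun _ => hPQ.ae_le h⟩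
    · exact ⟨0, measurable_const, fun h => absurd h hk⟩
  choose ξ hξ hrep using hrep
  refine ⟨ξ, Q[H|ℱ t], hξ, stronglyMeasurable_condExp.measurable, ?_⟩
  have hall : ∀ᵐ ω ∂P, ∀ k : Fin T, t ≤ k.castSucc →
      (Q[H|ℱ k.succ]) ω - (Q[H|ℱ k.castSucc]) ω = ξ k ω ⬝ᵥ increment X k ω :=
    ae_all_iff.2 fun k => by
      by_cases hk : t ≤ k.castSucc
      · filter_upwards [hrep k hk] with ω hω _ using hω
      · exact Filter.Eventually.of_forall fun ω h => absurd h hk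
  filter_upwards [hall] with ω hω
  have hlast : Q[H|ℱ (Fin.last T)] = H :=
    condExp_of_stronglyMeasurable (ℱ.le _) hH.1.stronglyMeasurable hHi
  have hsum := sum_sub_from_eq (fun s => (Q[H|ℱ s]) ω) t
  rw [gainsFrom_eq, Finset.sum_congr rfl fun k hk =>
    (hω k (by simpa using hk)).symm, hsum, hlast]
  ring

end Main

end CondFTAP

theorem mainTheorem1 {Ω : Type*} [mΩ : MeasurableSpace Ω] (P : Measure Ω) [IsProbabilityMeasure P]
    {T d : ℕ} (ℱ : Filtration (Fin (T + 1)) mΩ)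
    (hℱ0 : ∀ A : Set Ω, MeasurableSet[ℱ 0] A → P A = 0 ∨ P A = 1)
    (hℱT : ℱ (Fin.last T) = mΩ)
    (X : Fin (T + 1) → Ω → Fin d → ℝ) (hX : Adapted ℱ X)
    (hNA : CondFTAP.ArbitrageFree P ℱ X) (t : Fin (T + 1)) :
    List.TFAE [
      CondFTAP.CompleteAt P ℱ X t,
      ∀ H : Ω → ℝ, CondFTAP.IsClaim P ℱ H → CondFTAP.HasUniquePrice P ℱ X t H,
      ∃ Qstar ∈ CondFTAP.equivMartingaleMeasures P ℱ X,
        CondFTAP.equivMartingaleMeasures P ℱ X = CondFTAP.pastingSet (ℱ t) (ℱ.le t)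
          (CondFTAP.equivMartingaleMeasures P ℱ X) Qstar,
      ∀ Qstar ∈ CondFTAP.equivMartingaleMeasures P ℱ X,
        CondFTAP.equivMartingaleMeasures P ℱ X = CondFTAP.pastingSet (ℱ t) (ℱ.le t)
          (CondFTAP.equivMartingaleMeasures P ℱ X) Qstar] := by
  tfae_have 1 → 2 := fun h H hH => h.hasUniquePrice hX hNA hH
  tfae_have 2 → 4 := fun h Qstar hQs => CondFTAP.eq_pastingSet_of_hasUniquePrice hℱT hX h hQs
  tfae_have 4 → 3 := fun h => by
    obtain ⟨Q, hQ, hQP, hPQ, -, hM⟩ :=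
      hNA.exists_martingaleMeasure hX (H := fun _ => 0) measurable_const
    have hmem : (⟨Q, hQ⟩ : ProbabilityMeasure Ω) ∈ CondFTAP.equivMartingaleMeasures P ℱ X :=
      ⟨hQP, hPQ, hM⟩
    exact ⟨_, hmem, h _ hmem⟩
  tfae_have 3 → 1 := fun ⟨_, _, h⟩ => CondFTAP.completeAt_of_eq_pastingSet hX hNA h
  tfae_finish
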